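/- Let $\mathcal A,\mathcal B$ be the potentials of a static, spherically symmetric metric in isotropic coordinates, $$ds^2=\mathcal A(r)(dx^0)^2-\frac{1}{\mathcal B(r)}\,\delta_{ij}dx^idx^j,\qquad r=|\boldsymbol x|,$$ where, with $m=GM/c^2$ and for all $r>r_h$ ($r_h=\rho m$ with a constant $\rho>0$), $\mathcal A$ and $1/\mathcal B$ are positive and are sums of convergent power series in $m/r$ with numerical coefficients, $$\mathcal A(r)=1-\frac{2m}{r}+2\beta\frac{m^2}{r^2}+\cdots,\qquad \frac1{\mathcal B(r)}=1+2\gamma\frac mr+\frac32\epsilon\frac{m^2}{r^2}+\cdots .$$ Put $\mathcal D_h=\{|\boldsymbol x|>r_h\}$ and $\kappa=\frac14[8(1+\gamma)-4\beta+3\epsilon]$. Let $\boldsymbol N_e$ be a unit vector and $\boldsymbol x_B$ a point, with $\boldsymbol n_B=\boldsymbol x_B/|\boldsymbol x_B|$, such that the straight half-line $\boldsymbol x_B+(\sigma-\sigma_B)\boldsymbol N_e$, $\sigma\le\sigma_B$, lies in $\mathcal D_h$, and let $\phi_B\in[0,\pi]$ be the Euclidean angle between $\boldsymbol N_e$ and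 $\boldsymbol n_B$, with $\phi_B\neq\pi$ (the ray is not radial). Let $\Gamma_s$ be a quasi-Minkowskian light ray emitted at infinity in the direction $\boldsymbol N_e$ and received at $\boldsymbol x_B$ at the instant $x^0_B$: for each sufficiently small $G>0$ it is a future directed null geodesic contained in $\mathcal D_h$, with affine parameter $\sigma\in(-\infty,\sigma_B]$, with $|\boldsymbol x|\to\infty$ and unit tangent $\to\boldsymbol N_e$ as $\sigma\to-\infty$, whose equations have the form $$x^0=x^0_B+\sigma-\sigma_B+\sum_{n\ge1}G^nX^0_{(n)}(\sigma),\qquad \boldsymbol x=\boldsymbol x_B+(\sigma-\sigma_B)\boldsymbol N_e+\sum_{n\ge1}G^n\boldsymbol X_{(n)}(\sigma),$$ where $X^0_{(n)},\boldsymbol X_{(n)}$ do not depend on $G$ and vanish at $\sigma_B$. Let $b=|\boldsymbol x\times\widehat{\underline{\boldsymbol l}}|$ be its impact parameter, that is, the magnitude of the conserved angular momentum $-\boldsymbol x\times\widehat{\underline{\boldsymbol l}}$, where $\widehat{\underline{\boldsymbol l}}=(l_i/l_0)$ is formed from the covariant components of the tangent vector. The gravitational deflection of $\Gamma_s$ relative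 to the static observer at $\boldsymbol x_B$ is $$\Delta\chi_B(\Gamma_s)=-\big[\delta_B(\Gamma_s,\Gamma_{rd}^-)-\delta_{\mathcal E}(\boldsymbol N_e,-\boldsymbol n_B)\big],$$ where $\Gamma^-_{rd}$ is the ingoing radial null geodesic from infinity arriving at $\boldsymbol x_B$ at the same instant, $\delta_B\in[0,\pi]$ is the angle between the two rays measured by the static observer, and $\delta_{\mathcal E}\in[0,\pi]$ is the Euclidean angle. Then, for $G>0$ small enough, $b>0$ and $$\Delta\chi_B(\Gamma_s)=\frac{(1+\gamma)GM}{c^2b}(1+\cos\phi_B)+\frac{G^2M^2}{c^4b^2}\Big[\kappa\big(\pi-\phi_B+\tfrac12\sin2\phi_B\big)-(1+\gamma)^2(1+\cos\phi_B)\sin\phi_B\Big]+O\!\left(\frac{G^3M^3}{c^6b^3}\right)$$ as $G\to0^+$, where the constant in $O$ depends only on the coefficients of the two power series and on $\rho$. -/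

import Mathlib

open Filter Topology

/-- Ordered triples, with the Euclidean scalar product and norm. -/
abbrev E3 : Type := EuclideanSpace ℝ (Fin 3)

/-- The Euclidean vector product of two triples. -/
noncomputable def E3.cross (a b : E3) : E3 :=
  WithLp.toLp 2 (crossProduct (WithLp.ofLp a) (WithLp.ofLp b))

/-- The data of a static, spherically symmetric, asymptotically flat metric in isotropic
coordinates, `ds² = 𝒜(r) (dx⁰)² - ℬ(r)⁻¹ |dx|²`, whose potentials are convergent power series in
`m / r` in the exterior region `r > rh`, with `rh = ρ m`:
`𝒜(r) = 1 - 2 m/r + 2 β m²/r² + ⋯` and `1/ℬ(r) = 1 + 2 γ m/r + (3/2) ε m²/r² + ⋯`.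
The coefficients are pure numbers, so the same data give the metric for every value of `m`. -/
structure StaticMetric where
  /-- post-Newtonian parameter -/
  β : ℝ
  /-- post-Newtonian parameter -/
  γ : ℝ
  /-- post-post-Newtonian parameter -/
  ε : ℝ
  /-- the ratio `rh / m` -/
  ρ : ℝ
  /-- coefficients of `𝒜` -/
  coeffA : ℕ → ℝ
  /-- coefficients of `1/ℬ` -/
  coeffW : ℕ → ℝ
  ρ_pos : 0 < ρ
  coeffA_zero : coeffA 0 = 1
  coeffA_one : coeffA 1 = -2
  coeffA_two : coeffA 2 = 2 * β
  coeffW_zero : coeffW 0 = 1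
  coeffW_one : coeffW 1 = 2 * γ
  coeffW_two : coeffW 2 = 3 / 2 * ε
  summableA : ∀ u : ℝ, 0 < u → ρ * u < 1 → Summable fun k => coeffA k * u ^ k
  summableW : ∀ u : ℝ, 0 < u → ρ * u < 1 → Summable fun k => coeffW k * u ^ k
  posA : ∀ u : ℝ, 0 < u → ρ * u < 1 → 0 < ∑' k, coeffA k * u ^ k
  posW : ∀ u : ℝ, 0 < u → ρ * u < 1 → 0 < ∑' k, coeffW k * u ^ k

namespace StaticMetric

variable (S : StaticMetric)

/-- `κ = (8 (1 + γ) - 4 β + 3 ε) / 4`. -/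
noncomputable def κ : ℝ := (8 * (1 + S.γ) - 4 * S.β + 3 * S.ε) / 4

/-- The potential `𝒜(r)`. -/
noncomputable def A (m r : ℝ) : ℝ := ∑' k, S.coeffA k * (m / r) ^ k

/-- The function `W(r) = 1/ℬ(r)`. -/
noncomputable def W (m r : ℝ) : ℝ := ∑' k, S.coeffW k * (m / r) ^ k

/-- The radius `rh` bounding the exterior region `𝒟ₕ = {x : |x| > rh}`. -/
noncomputable def rh (m : ℝ) : ℝ := S.ρ * m

/-- The Lorentzian scalar product of two 4-vectors at the spatial point `x`;
a 4-vector is given by its contravariant components `(V⁰, V)`. -/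
noncomputable def lor (m : ℝ) (x : E3) (V V' : ℝ × E3) : ℝ :=
  S.A m ‖x‖ * (V.1 * V'.1) - S.W m ‖x‖ * inner ℝ V.2 V'.2

end StaticMetric

/-- A parametrized path `ζ ↦ (x⁰(ζ), x(ζ))` together with its velocity `(dx⁰/dζ, dx/dζ)`; that the
last two fields are indeed the derivatives of the first two is part of `IsLightPath`. -/
structure SpacetimePath where
  time : ℝ → ℝ
  pos : ℝ → E3
  timeVel : ℝ → ℝ
  vel : ℝ → E3

/-- The tangent 4-vector. -/
def SpacetimePath.tangent (p : SpacetimePath) (ζ : ℝ) : ℝ × E3 := (p.timeVel ζ, p.vel ζ)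

/-- `p`, restricted to `ζ ≤ ζB`, is a future directed, affinely parametrized null geodesic path of
the metric `S` with mass parameter `m`, lying entirely in the region `𝒟ₕ`. The geodesic equations
are written in covariant components, `d(g_{αβ} ẋ^β)/dζ = (1/2) (∂_α g_{μν}) ẋ^μ ẋ^ν`. -/
structure IsLightPath (S : StaticMetric) (m : ℝ) (ζB : ℝ) (p : SpacetimePath) : Prop where
  hasDeriv_time : ∀ ζ ≤ ζB, HasDerivWithinAt p.time (p.timeVel ζ) (Set.Iic ζB) ζ
  hasDeriv_pos : ∀ ζ ≤ ζB, HasDerivWithinAt p.pos (p.vel ζ) (Set.Iic ζB) ζ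
  exterior : ∀ ζ ≤ ζB, S.rh m < ‖p.pos ζ‖
  future : ∀ ζ ≤ ζB, 0 < p.timeVel ζ
  null : ∀ ζ ≤ ζB, S.lor m (p.pos ζ) (p.tangent ζ) (p.tangent ζ) = 0
  geodesic_time : ∀ ζ ≤ ζB,
    HasDerivWithinAt (fun τ => S.A m ‖p.pos τ‖ * p.timeVel τ) 0 (Set.Iic ζB) ζ
  geodesic_pos : ∀ ζ ≤ ζB,
    HasDerivWithinAt (fun τ => -(S.W m ‖p.pos τ‖ • p.vel τ))
      ((1 / 2 * (deriv (S.A m) ‖p.pos ζ‖ * p.timeVel ζ ^ 2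
          - deriv (S.W m) ‖p.pos ζ‖ * ‖p.vel ζ‖ ^ 2)) • (‖p.pos ζ‖⁻¹ • p.pos ζ))
      (Set.Iic ζB) ζ

/-- `p` is a light path emitted at infinity in the direction of the unit vector `N` and received at
the spatial point `xB` at the instant `x⁰ = tB` (for the value `ζB` of the parameter). -/
structure IsRayFromInfinity (S : StaticMetric) (m : ℝ) (N xB : E3) (tB ζB : ℝ)
    (p : SpacetimePath) : Prop where
  light : IsLightPath S m ζB p
  time_end : p.time ζB = tB
  pos_end : p.pos ζB = xB
  from_infinity : Tendsto (fun ζ => ‖p.pos ζ‖) atBot atTop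
  direction : Tendsto (fun ζ => ‖p.vel ζ‖⁻¹ • p.vel ζ) atBot (𝓝 N)

/-- The mass parameter `m = G M / c²`. -/
noncomputable def massParam (M c G : ℝ) : ℝ := G * M / c ^ 2

/-- A quasi-Minkowskian light ray emitted at infinity in the direction `N` and received at `xB`: for
every value `0 < G < G₀` of the gravitational constant `Γ G` is a light path, emitted at infinity in
the direction `N` and received at `xB`, of the metric with `m = G M / c²`, and its parametric
equations are the Minkowskian ones plus power series in `G` whose coefficients do not depend on `G`
and vanish at the reception point. -/
structure IsQuasiMinkowskian (S : StaticMetric) (M c G₀ : ℝ) (N xB : E3) (tB σB : ℝ)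
    (Γ : ℝ → SpacetimePath) : Prop where
  ray : ∀ G, 0 < G → G < G₀ → IsRayFromInfinity S (massParam M c G) N xB tB σB (Γ G)
  expansion : ∃ (X0 : ℕ → ℝ → ℝ) (X : ℕ → ℝ → E3),
    (∀ n, 1 ≤ n → X0 n σB = 0 ∧ X n σB = 0) ∧
    ∀ G, 0 < G → G < G₀ → ∀ σ ≤ σB,
      HasSum (fun n : ℕ => G ^ (n + 1) * X0 (n + 1) σ) ((Γ G).time σ - (tB + (σ - σB))) ∧
      HasSum (fun n : ℕ => G ^ (n + 1) • X (n + 1) σ) ((Γ G).pos σ - (xB + (σ - σB) • N))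

/-- `x / |x|`. -/
noncomputable def unitVec (x : E3) : E3 := ‖x‖⁻¹ • x

/-- The ingoing radial null geodesic path arriving at `xB` at the instant `tB`: it comes from
infinity in the direction `-xB / |xB|`, along the half-line spanned by `xB`. -/
structure IsIngoingRadial (S : StaticMetric) (m : ℝ) (xB : E3) (tB ζB : ℝ)
    (p : SpacetimePath) : Prop where
  ray : IsRayFromInfinity S m (-unitVec xB) xB tB ζB p
  radial : ∀ ζ ≤ ζB, p.pos ζ = ‖p.pos ζ‖ • unitVec xB

namespace StaticMetric

variable (S : StaticMetric)

/-- The direction triple `(l_i / l_0)` of the 4-vector `l` at `x`, where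
`l_0 = 𝒜 l⁰` and `l_i = - l^i / ℬ` are the covariant components of `l`. -/
noncomputable def directionTriple (m : ℝ) (x : E3) (l : ℝ × E3) : E3 :=
  (S.A m ‖x‖ * l.1)⁻¹ • (-(S.W m ‖x‖ • l.2))

/-- The impact parameter: the magnitude of the conserved angular momentum `-x × (l_i / l_0)`
of the ray with tangent vector `l` at `x`. -/
noncomputable def impactParameter (m : ℝ) (x : E3) (l : ℝ × E3) : ℝ :=
  ‖-(E3.cross x (S.directionTriple m x l))‖

/-- The unit 4-velocity of the static observer staying at `x`. -/
noncomputable def observer (m : ℝ) (x : E3) : ℝ × E3 := (1 / Real.sqrt (S.A m ‖x‖), 0)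

/-- The direction of propagation of a ray with tangent vector `l`, relative to the static observer
at `x`: the unit 4-vector `l / (U · l) - U`. -/
noncomputable def observedDirection (m : ℝ) (x : E3) (l : ℝ × E3) : ℝ × E3 :=
  (S.lor m x (S.observer m x) l)⁻¹ • l - S.observer m x

/-- The angle in `[0, π]` between two rays with tangent vectors `l`, `l'` at `x`, as measured by the
static observer at `x`. -/
noncomputable def measuredAngle (m : ℝ) (x : E3) (l l' : ℝ × E3) : ℝ :=
  Real.arccos (-(S.lor m x (S.observedDirection m x l) (S.observedDirection m x l')))

/-- The gravitational contribution to the angular separation, at `x`, between two rays emitted at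
infinity in the directions `N`, `N'` and having tangent vectors `l`, `l'` at `x`. -/
noncomputable def gravSeparation (m : ℝ) (x N N' : E3) (l l' : ℝ × E3) : ℝ :=
  S.measuredAngle m x l l' - InnerProductGeometry.angle N N'

/-- The gravitational deflection, relative to the static observer at `x`, of a ray emitted at
infinity in the direction `N` and having tangent vector `l` at `x`; `lrd` is the tangent vector
at `x` of the ingoing radial null geodesic path, emitted in the direction `-x/|x|`. -/
noncomputable def deflection (m : ℝ) (x N : E3) (l lrd : ℝ × E3) : ℝ :=
  -(S.gravSeparation m x N (-unitVec x) l lrd)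

end StaticMetric

open RealInnerProductSpace

/-! ### Taylor remainders of analytic functions -/

/-! In isotropic coordinates a null ray behaves like light in a medium of refractive index `n(u) =
√(1 / (𝒜 ℬ))`, `u = m / r`. The normalized momentum `P = -(l_i / l_0)` has `|P| = n`, and `x × P =
J` is constant with `|J| = b`. Let `ψ` be the angle between `x` and `P`, and `v = m / b`. Then `v
sin ψ = u / n`, and when the polar angle turns at the rate `θ`, `ψ` changes at the rate `-θ (1 - u
n' / n)`.

The orbit is never integrated. Instead the direction of `P` is corrected by `Φ(ψ) = approxDeflection
v ψ`, which gives a unit vector `w` at the angle `ψ - Φ(ψ)` from `x`. Since `Φ'` is a polynomial in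
`v sin ψ = u / n`, `w` turns at the rate `θ * defect u`, and `Φ` is such that `defect u = O(u³)`.
With `u ≤ 2 v` and `ψ` monotone, the total rotation of `w` is `O(v³)`. At past infinity `ψ → π` and
`Φ(π) = 0`, so `w → N_e`. Hence `w` is within `O(v³)` of `N_e` at reception
(`norm_polarVec_sub_direction_le`), that is, `ψ - Φ(ψ) - φ_B = O(v³)`.

Measured angles are Euclidean (`measuredAngle_eq`), so the deflection is `ψ - φ_B`
(`deflection_eq`). Solving the relation above to second order (`exists_deflection_taylor`) gives the
formula, with constants depending on the metric coefficients alone.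

The expansion in `G` serves only to show that `P → N_e` at reception (`tendsto_momentum`). Then `b`
has a positive limit, `v → 0`, and the whole ray stays in the weak field (`ratio_lt`). -/

theorem analyticAt_tsum_mul_pow {c : ℕ → ℝ} {r : ℝ} (hr : 0 < r)
    (hc : Summable fun k => c k * r ^ k) : AnalyticAt ℝ (fun u : ℝ => ∑' k, c k * u ^ k) 0 := by
  have hrad : 0 < (FormalMultilinearSeries.ofScalars ℝ c).radius := by
    refine lt_of_lt_of_le (b := ((r.toNNReal : NNReal) : ENNReal)) (by simpa using hr) ?_
    apply FormalMultilinearSeries.le_radius_of_summable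
    simpa [FormalMultilinearSeries.ofScalars_norm, Real.coe_toNNReal _ hr.le, abs_mul,
      abs_of_pos hr] using hc.norm
  have h := (FormalMultilinearSeries.ofScalars ℝ c).hasFPowerSeriesOnBall hrad
  have h2 := h.analyticAt
  have h3 : (FormalMultilinearSeries.ofScalars ℝ c).sum = fun u : ℝ => ∑' k, c k * u ^ k := by
    have := FormalMultilinearSeries.ofScalarsSum_eq_tsum (E := ℝ) c
    simpa [FormalMultilinearSeries.ofScalarsSum] using this
  rwa [h3] at h2

theorem AnalyticAt.exists_eq_add_mul {f : ℝ → ℝ} (hf : AnalyticAt ℝ f 0) :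
    ∃ g : ℝ → ℝ, AnalyticAt ℝ g 0 ∧ ∀ u, f u = f 0 + u * g u := by
  obtain ⟨p, hp⟩ := hf
  refine ⟨dslope f 0, ⟨_, hp.has_fpower_series_dslope_fslope⟩, fun u => ?_⟩
  have := sub_smul_dslope f 0 u
  simp only [sub_zero, smul_eq_mul] at this
  linarith

theorem AnalyticAt.exists_taylor_three {f : ℝ → ℝ} (hf : AnalyticAt ℝ f 0) :
    ∃ (c d : ℝ) (g : ℝ → ℝ), AnalyticAt ℝ g 0 ∧
      ∀ u, f u = f 0 + c * u + d * u ^ 2 + u ^ 3 * g u := by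
  obtain ⟨g, hg, h⟩ := hf.exists_eq_add_mul
  obtain ⟨g2, hg2, h2⟩ := hg.exists_eq_add_mul
  obtain ⟨g3, hg3, h3⟩ := hg2.exists_eq_add_mul
  refine ⟨g 0, g2 0, g3, hg3, fun u => ?_⟩
  rw [h u, h2 u, h3 u]; ring

/-- The identity is required only for `u > 0`, the side on which the power series are known to
converge; dividing by `u` and letting `u → 0⁺` extracts the coefficients one after the other. -/
theorem taylor_coeff_eq_zero {a b c : ℝ} {g : ℝ → ℝ} (hg : ContinuousAt g 0)
    (h : ∀ᶠ u in 𝓝[>] (0 : ℝ), a + b * u + c * u ^ 2 + u ^ 3 * g u = 0) :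
    a = 0 ∧ b = 0 ∧ c = 0 := by
  have hid : Tendsto (fun u : ℝ => u) (𝓝[>] (0 : ℝ)) (𝓝 0) := tendsto_id.mono_left nhdsWithin_le_nhds
  have hg' : Tendsto g (𝓝[>] (0 : ℝ)) (𝓝 (g 0)) := hg.tendsto.mono_left nhdsWithin_le_nhds
  have ha : a = 0 := by
    have h1 : Tendsto (fun u => a + b * u + c * u ^ 2 + u ^ 3 * g u) (𝓝[>] (0 : ℝ))
        (𝓝 (a + b * 0 + c * 0 ^ 2 + 0 ^ 3 * g 0)) :=
      (((tendsto_const_nhds).add (hid.const_mul b)).add ((hid.pow 2).const_mul c)).add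
        ((hid.pow 3).mul hg')
    have h2 := (tendsto_congr' h).1 h1
    have := tendsto_nhds_unique h2 tendsto_const_nhds
    simpa using this
  subst ha
  have hb : b = 0 := by
    have h1 : Tendsto (fun u => b + c * u + u ^ 2 * g u) (𝓝[>] (0 : ℝ))
        (𝓝 (b + c * 0 + 0 ^ 2 * g 0)) :=
      ((tendsto_const_nhds).add (hid.const_mul c)).add ((hid.pow 2).mul hg')
    have h' : ∀ᶠ u in 𝓝[>] (0 : ℝ), b + c * u + u ^ 2 * g u = 0 := by
      filter_upwards [h, self_mem_nhdsWithin] with u hu hu0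
      have hu0 : u ≠ 0 := ne_of_gt hu0
      apply mul_left_cancel₀ hu0
      linear_combination hu
    have := tendsto_nhds_unique ((tendsto_congr' h').1 h1) tendsto_const_nhds
    simpa using this
  subst hb
  refine ⟨rfl, rfl, ?_⟩
  have h1 : Tendsto (fun u => c + u * g u) (𝓝[>] (0 : ℝ)) (𝓝 (c + 0 * g 0)) :=
    (tendsto_const_nhds).add (hid.mul hg')
  have h' : ∀ᶠ u in 𝓝[>] (0 : ℝ), c + u * g u = 0 := by
    filter_upwards [h, self_mem_nhdsWithin] with u hu hu0
    have hu0 : u ≠ 0 := ne_of_gt hu0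
    apply mul_left_cancel₀ (pow_ne_zero 2 hu0)
    linear_combination hu
  have := tendsto_nhds_unique ((tendsto_congr' h').1 h1) tendsto_const_nhds
  simpa using this

theorem tsum_mul_pow_eq {c : ℕ → ℝ} {u : ℝ} (hc : Summable fun k => c k * u ^ k) :
    ∑' k, c k * u ^ k = c 0 + c 1 * u + c 2 * u ^ 2 + u ^ 3 * ∑' k, c (k + 3) * u ^ k := by
  rw [← hc.sum_add_tsum_nat_add 3, ← tsum_mul_left]
  simp only [Finset.sum_range_succ, Finset.sum_range_zero]
  congr 1
  · ring
  · exact tsum_congr fun k => by ring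

/-! ### Second order expansion of the optical index. -/

namespace StaticMetric

variable (S : StaticMetric)

/-- `𝒜` as a function of `u = m / r`. -/
noncomputable def serA (u : ℝ) : ℝ := ∑' k, S.coeffA k * u ^ k

/-- `1 / ℬ` as a function of `u = m / r`. -/
noncomputable def serW (u : ℝ) : ℝ := ∑' k, S.coeffW k * u ^ k

/-- The optical index `√(1 / (𝒜 ℬ))` as a function of `u = m / r`. -/
noncomputable def index (u : ℝ) : ℝ := √(S.serW u / S.serA u)

theorem radius_half : 0 < 1 / (2 * S.ρ) ∧ S.ρ * (1 / (2 * S.ρ)) < 1 := by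
  have := S.ρ_pos
  refine ⟨by positivity, ?_⟩
  field_simp; norm_num

theorem analyticAt_serA : AnalyticAt ℝ S.serA 0 :=
  analyticAt_tsum_mul_pow S.radius_half.1 (S.summableA _ S.radius_half.1 S.radius_half.2)

theorem analyticAt_serW : AnalyticAt ℝ S.serW 0 :=
  analyticAt_tsum_mul_pow S.radius_half.1 (S.summableW _ S.radius_half.1 S.radius_half.2)

theorem serA_zero : S.serA 0 = 1 := by
  rw [serA, tsum_eq_single 0 (fun k hk => by simp [hk])]; simp [S.coeffA_zero]

theorem serW_zero : S.serW 0 = 1 := by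
  rw [serW, tsum_eq_single 0 (fun k hk => by simp [hk])]; simp [S.coeffW_zero]

theorem index_zero : S.index 0 = 1 := by simp [index, serA_zero, serW_zero]

theorem analyticAt_index : AnalyticAt ℝ S.index 0 := by
  have h1 : AnalyticAt ℝ (fun u => S.serW u / S.serA u) 0 :=
    S.analyticAt_serW.div S.analyticAt_serA (by simp [serA_zero])
  have h2 : AnalyticAt ℝ (fun x : ℝ => √x) (S.serW 0 / S.serA 0) := by
    have : ContDiffAt ℝ ⊤ (fun x : ℝ => √x) (S.serW 0 / S.serA 0) :=
      Real.contDiffAt_sqrt (by simp [serA_zero, serW_zero])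
    exact this.analyticAt
  exact AnalyticAt.comp (g := fun x : ℝ => √x) (f := fun u => S.serW u / S.serA u) h2 h1

/-- Points with `0 < u` small lie in the region of convergence. -/
theorem eventually_exterior : ∀ᶠ u in 𝓝[>] (0 : ℝ), 0 < u ∧ S.ρ * u < 1 := by
  have h : ∀ᶠ u in 𝓝[>] (0 : ℝ), u < 1 / S.ρ :=
    nhdsWithin_le_nhds (Iio_mem_nhds (by have := S.ρ_pos; positivity))
  filter_upwards [h, self_mem_nhdsWithin] with u hu hu0
  refine ⟨hu0, ?_⟩
  rw [lt_div_iff₀ S.ρ_pos] at hu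
  linarith

theorem index_sq_mul {u : ℝ} (hu : 0 < u) (hu' : S.ρ * u < 1) :
    S.index u ^ 2 * S.serA u = S.serW u := by
  have hA : 0 < S.serA u := S.posA u hu hu'
  have hW : 0 < S.serW u := S.posW u hu hu'
  rw [index, Real.sq_sqrt (by positivity)]
  field_simp

/-- Comparing coefficients in `index² * serA = serW` determines both coefficients; `κ` appears as
the quadratic one plus `(1 + γ)² / 2`. -/
theorem exists_index_taylor : ∃ g : ℝ → ℝ, AnalyticAt ℝ g 0 ∧
    ∀ u, S.index u = 1 + (1 + S.γ) * u + (S.κ - (1 + S.γ) ^ 2 / 2) * u ^ 2 + u ^ 3 * g u := by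
  obtain ⟨c, d, g, hg, h⟩ := S.analyticAt_index.exists_taylor_three
  rw [index_zero] at h
  have hAr := analyticAt_tsum_mul_pow (c := fun k => S.coeffA (k + 3)) S.radius_half.1 (by
    have := (summable_nat_add_iff 3).2 (S.summableA _ S.radius_half.1 S.radius_half.2)
    refine (this.mul_right (((1 / (2 * S.ρ)) ^ 3)⁻¹)).congr fun k => ?_
    rw [pow_add, ← mul_assoc, mul_inv_cancel_right₀ (pow_ne_zero _ S.radius_half.1.ne')])
  have hWr := analyticAt_tsum_mul_pow (c := fun k => S.coeffW (k + 3)) S.radius_half.1 (by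
    have := (summable_nat_add_iff 3).2 (S.summableW _ S.radius_half.1 S.radius_half.2)
    refine (this.mul_right (((1 / (2 * S.ρ)) ^ 3)⁻¹)).congr fun k => ?_
    rw [pow_add, ← mul_assoc, mul_inv_cancel_right₀ (pow_ne_zero _ S.radius_half.1.ne')])
  set ar : ℝ → ℝ := fun u => ∑' k, S.coeffA (k + 3) * u ^ k
  set wr : ℝ → ℝ := fun u => ∑' k, S.coeffW (k + 3) * u ^ k
  -- This is `index² * serA - serW` sorted by powers of `u`; the factor of `u ^ 3` matters only
  -- through its continuity at `0`.
  have key : ∀ᶠ u in 𝓝[>] (0 : ℝ), 0 + (2 * c - 2 - 2 * S.γ) * u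
      + (2 * d + c ^ 2 - 4 * c + 2 * S.β - 3 / 2 * S.ε) * u ^ 2
      + u ^ 3 * (-wr u + (2 * d * c + 2 * g u + 2 * u * c * g u + u * d ^ 2 + 2 * u ^ 2 * d * g u
          + u ^ 3 * g u ^ 2) * (1 - 2 * u + 2 * S.β * u ^ 2 + u ^ 3 * ar u)
        + (-2) * (2 * d + c ^ 2) + 2 * S.β * (2 * c + (2 * d + c ^ 2) * u)
        + ar u * (1 + 2 * c * u + (2 * d + c ^ 2) * u ^ 2)) = 0 := by
    filter_upwards [S.eventually_exterior] with u hu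
    have e := S.index_sq_mul hu.1 hu.2
    have eA : S.serA u = 1 - 2 * u + 2 * S.β * u ^ 2 + u ^ 3 * ar u := by
      rw [serA, tsum_mul_pow_eq (S.summableA u hu.1 hu.2), S.coeffA_zero, S.coeffA_one, S.coeffA_two]
      ring
    have eW : S.serW u = 1 + 2 * S.γ * u + 3 / 2 * S.ε * u ^ 2 + u ^ 3 * wr u := by
      rw [serW, tsum_mul_pow_eq (S.summableW u hu.1 hu.2), S.coeffW_zero, S.coeffW_one, S.coeffW_two]
    rw [eA, eW, h u] at e
    linear_combination e
  have hgc := hg.continuousAt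
  have hac : ContinuousAt ar 0 := hAr.continuousAt
  have hwc : ContinuousAt wr 0 := hWr.continuousAt
  obtain ⟨-, h1, h2⟩ := taylor_coeff_eq_zero (by fun_prop) key
  refine ⟨g, hg, fun u => ?_⟩
  have hc : c = 1 + S.γ := by linarith
  have hd : d = S.κ - (1 + S.γ) ^ 2 / 2 := by
    rw [hc] at h2
    rw [κ]; linarith
  rw [h u, hc, hd]

/-- The relative rate of change of the polar angle along a ray which is not compensated by the
second order approximation of the deflection. -/
noncomputable def defect (u : ℝ) : ℝ :=
  1 - (1 - u * deriv S.index u / S.index u)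
    * (1 + (1 + S.γ) * (u / S.index u) + 2 * S.κ * (u / S.index u) ^ 2)

/-- With `n = 1 + a u + d u² + ⋯`, the terms in `u` cancel and the coefficient of `u²` is a multiple
of `2 d + a² - 2 κ`, which vanishes by `exists_index_taylor`. This cancellation dictates the
coefficients of `approxDeflection`. -/
theorem exists_defect_bound : ∃ K : ℝ, 0 < K ∧ ∀ᶠ u in 𝓝[>] (0 : ℝ), |S.defect u| ≤ K * u ^ 3 := by
  obtain ⟨g, hg, h⟩ := S.exists_index_taylor
  set a := 1 + S.γ with ha
  set κ := S.κ
  set d := κ - a ^ 2 / 2 with hd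
  have hderiv : ∀ᶠ u in 𝓝 (0 : ℝ), deriv S.index u
      = a + 2 * d * u + u ^ 2 * (3 * g u + u * deriv g u) := by
    filter_upwards [hg.eventually_analyticAt] with u hgu
    have h1 : HasDerivAt (fun u => 1 + a * u + d * u ^ 2 + u ^ 3 * g u)
        (a * 1 + d * (2 * u) + (3 * u ^ 2 * g u + u ^ 3 * deriv g u)) u := by
      have e1 := ((hasDerivAt_id u).const_mul a).const_add 1
      have e2 := ((hasDerivAt_pow 2 u).const_mul d)
      have e3 := (hasDerivAt_pow 3 u).mul hgu.differentiableAt.hasDerivAt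
      refine ((e1.add e2).add e3).congr_deriv ?_
      simp
    have h2 : S.index = fun u => 1 + a * u + d * u ^ 2 + u ^ 3 * g u := funext h
    rw [h2, h1.deriv]; ring
  have hgc := hg.continuousAt
  have hgc' : ContinuousAt (deriv g) 0 := hg.deriv.continuousAt
  have hNc := S.analyticAt_index.continuousAt
  have hN : ∀ᶠ u in 𝓝 (0 : ℝ), 0 < S.index u :=
    hNc.eventually (lt_mem_nhds (by rw [index_zero]; norm_num))
  have hex : ∃ P : ℝ → ℝ, ContinuousAt P 0 ∧ ∀ᶠ u in 𝓝 (0 : ℝ), S.defect u = u ^ 3 * P u := by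
    refine ⟨fun u => (a ^ 2 * (a + d * u + u ^ 2 * g u)
      + 2 * d * (2 * (a + d * u + u ^ 2 * g u) + u * (a + d * u + u ^ 2 * g u) ^ 2)
      + 2 * a * d * S.index u + a * g u * S.index u * u + g u * S.index u ^ 2 + 2 * d * κ * u
      + (2 * g u + u * deriv g u) * (S.index u ^ 2 + a * u * S.index u + 2 * κ * u ^ 2))
      / S.index u ^ 3, ?_, ?_⟩
    · refine ContinuousAt.div (by fun_prop) (hNc.pow 3) (by simp [index_zero])
    · filter_upwards [hderiv, hN] with u h1 h2
      rw [defect, h1, ← ha]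
      field_simp
      rw [h u]
      simp only [hd]
      ring
  obtain ⟨P, hP, hPe⟩ := hex
  refine ⟨|P 0| + 1, by positivity, ?_⟩
  have hb : ∀ᶠ u in 𝓝 (0 : ℝ), |P u| < |P 0| + 1 :=
    hP.abs.eventually (gt_mem_nhds (by linarith))
  filter_upwards [nhdsWithin_le_nhds hPe, nhdsWithin_le_nhds hb, self_mem_nhdsWithin] with u h1 h2 h3
  have h3 : 0 < u := h3
  rw [h1, abs_mul, abs_of_pos (pow_pos h3 3), mul_comm]
  exact mul_le_mul_of_nonneg_right h2.le (by positivity)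

end StaticMetric

/-! ### Uniform bounds in the weak field region. -/

namespace StaticMetric

variable (S : StaticMetric)

/-- Bounds valid at points where `u = m / r` is small. -/
structure WeakField (K u : ℝ) : Prop where
  diffA : DifferentiableAt ℝ S.serA u
  diffW : DifferentiableAt ℝ S.serW u
  serA_ge : 1 / 2 ≤ S.serA u
  serA_le : S.serA u ≤ 2
  serW_ge : 1 / 2 ≤ S.serW u
  derivA_le : |deriv S.serA u| ≤ K
  derivW_le : |deriv S.serW u| ≤ K
  serW_sub_one : |S.serW u - 1| ≤ K * u
  index_deriv : 2 * S.index u * deriv S.index u * S.serA u ^ 2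
    = deriv S.serW u * S.serA u - S.serW u * deriv S.serA u
  index_ge : 1 / 2 ≤ S.index u
  index_le : S.index u ≤ 2
  slope_le : u * deriv S.index u / S.index u ≤ 1 / 2
  defect_le : |S.defect u| ≤ K * u ^ 3

/-- Every bound follows from continuity at `u = 0`. The pair `δ`, `K` depends on the metric
coefficients only, which makes the final constant the same for all rays. -/
theorem exists_weakField : ∃ δ > 0, ∃ K > 0, ∀ u, 0 < u → u < δ → S.WeakField K u := by
  obtain ⟨K₀, hK₀, hdef⟩ := S.exists_defect_bound
  have hA := S.analyticAt_serA
  have hW := S.analyticAt_serW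
  have hN := S.analyticAt_index
  obtain ⟨w, hw, hwe⟩ := hW.exists_eq_add_mul
  rw [S.serW_zero] at hwe
  set K := K₀ + (|deriv S.serA 0| + 1) + (|deriv S.serW 0| + 1) + (|w 0| + 1) with hK
  have hKpos : 0 < K := by positivity
  suffices h : ∀ᶠ u in 𝓝[>] (0 : ℝ), S.WeakField K u by
    rw [eventually_nhdsWithin_iff, Metric.eventually_nhds_iff] at h
    obtain ⟨δ, hδ, h⟩ := h
    exact ⟨δ, hδ, K, hKpos, fun u h0 h1 => h (by simpa [abs_of_pos h0] using h1) h0⟩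
  have near {f : ℝ → ℝ} (hf : ContinuousAt f 0) {lo hi : ℝ} (h1 : lo < f 0) (h2 : f 0 < hi) :
      ∀ᶠ u in 𝓝[>] (0 : ℝ), lo ≤ f u ∧ f u ≤ hi := by
    apply nhdsWithin_le_nhds
    filter_upwards [hf.eventually (lt_mem_nhds h1), hf.eventually (gt_mem_nhds h2)] with u a b
    exact ⟨a.le, b.le⟩
  have bdd {f : ℝ → ℝ} (hf : ContinuousAt f 0) : ∀ᶠ u in 𝓝[>] (0 : ℝ), |f u| ≤ |f 0| + 1 := by
    filter_upwards [near hf.abs (lo := |f 0| - 1) (hi := |f 0| + 1) (by simp) (by simp)] with u hu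
    exact hu.2
  have hq : ContinuousAt (fun u => u * deriv S.index u / S.index u) 0 :=
    (continuousAt_id.mul hN.deriv.continuousAt).div hN.continuousAt (by simp [index_zero])
  filter_upwards [hdef, S.eventually_exterior,
    nhdsWithin_le_nhds hA.eventually_analyticAt, nhdsWithin_le_nhds hW.eventually_analyticAt,
    nhdsWithin_le_nhds hN.eventually_analyticAt,
    near hA.continuousAt (lo := 1 / 2) (hi := 2) (by norm_num [serA_zero]) (by norm_num [serA_zero]),
    near hW.continuousAt (lo := 1 / 2) (hi := 2) (by norm_num [serW_zero]) (by norm_num [serW_zero]),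
    near hN.continuousAt (lo := 1 / 2) (hi := 2) (by norm_num [index_zero])
      (by norm_num [index_zero]),
    near hq (lo := -1) (hi := 1 / 2) (by norm_num) (by norm_num),
    bdd hA.deriv.continuousAt, bdd hW.deriv.continuousAt, bdd hw.continuousAt] with
    u h1 h2 h3 h4 h5 h6 h7 h8 h9 h10 h11 h12
  have hu := h2.1
  have p1 := abs_nonneg (deriv S.serA 0)
  have p2 := abs_nonneg (deriv S.serW 0)
  have p3 := abs_nonneg (w 0)
  refine ⟨h3.differentiableAt, h4.differentiableAt, h6.1, h6.2, h7.1, by linarith,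
    by linarith, ?_, ?_, h8.1, h8.2, h9.2, h1.trans ?_⟩
  · rw [hwe u, add_sub_cancel_left, abs_mul, abs_of_pos hu, mul_comm]
    exact mul_le_mul_of_nonneg_right (by linarith) hu.le
  -- The relation comes from differentiating `index² * serA = serW`, valid in a neighbourhood of
  -- `u`, and multiplying by `serA`.
  · have hd := (h5.differentiableAt.hasDerivAt.pow 2).mul h3.differentiableAt.hasDerivAt
    have hev : ∀ᶠ v in 𝓝 u, S.index v ^ 2 * S.serA v = S.serW v := by
      have e1 : ∀ᶠ v in 𝓝 u, 0 < v := lt_mem_nhds hu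
      have e2 : ∀ᶠ v in 𝓝 u, S.ρ * v < 1 :=
        (continuous_const.mul continuous_id).continuousAt.eventually (gt_mem_nhds h2.2)
      filter_upwards [e1, e2] with v a b using S.index_sq_mul a b
    have h' := (hd.congr_of_eventuallyEq (f₁ := S.serW)
      (hev.mono fun v hv => by simp [hv])).deriv
    have e := S.index_sq_mul h2.1 h2.2
    simp only [Pi.pow_apply] at h'
    rw [h', ← e]
    push_cast
    ring
  · exact mul_le_mul_of_nonneg_right (by linarith) (by positivity)

end StaticMetric

/-! ### Algebra and calculus of the vector product. -/

namespace E3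

theorem inner_eq (a b : E3) : ⟪a, b⟫ = a 0 * b 0 + a 1 * b 1 + a 2 * b 2 := by
  simp [PiLp.inner_apply, Fin.sum_univ_three]; ring

theorem cross_zero (a b : E3) : cross a b 0 = a 1 * b 2 - a 2 * b 1 := by
  simp [cross, cross_apply]

theorem cross_one (a b : E3) : cross a b 1 = a 2 * b 0 - a 0 * b 2 := by
  simp [cross, cross_apply]

theorem cross_two (a b : E3) : cross a b 2 = a 0 * b 1 - a 1 * b 0 := by
  simp [cross, cross_apply]

theorem ext_three {a b : E3} (h0 : a 0 = b 0) (h1 : a 1 = b 1) (h2 : a 2 = b 2) : a = b := by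
  ext i; fin_cases i <;> assumption

theorem norm_cross_sq (a b : E3) : ‖cross a b‖ ^ 2 = ‖a‖ ^ 2 * ‖b‖ ^ 2 - ⟪a, b⟫ ^ 2 := by
  simp only [← real_inner_self_eq_norm_sq, inner_eq, cross_zero, cross_one, cross_two]; ring

theorem inner_cross_self_left (a b : E3) : ⟪cross a b, a⟫ = 0 := by
  simp only [inner_eq, cross_zero, cross_one, cross_two]; ring

theorem inner_cross_self_right (a b : E3) : ⟪cross a b, b⟫ = 0 := by
  simp only [inner_eq, cross_zero, cross_one, cross_two]; ring

theorem cross_cross_left (a b : E3) : cross (cross a b) a = ‖a‖ ^ 2 • b - ⟪a, b⟫ • a := by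
  apply ext_three <;>
  simp only [← real_inner_self_eq_norm_sq, inner_eq, cross_zero, cross_one, cross_two,
    PiLp.sub_apply, PiLp.smul_apply, smul_eq_mul] <;> ring

theorem cross_cross_self (a b : E3) : cross a (cross a b) = ⟪a, b⟫ • a - ‖a‖ ^ 2 • b := by
  apply ext_three <;>
  simp only [← real_inner_self_eq_norm_sq, inner_eq, cross_zero, cross_one, cross_two,
    PiLp.sub_apply, PiLp.smul_apply, smul_eq_mul] <;> ring

theorem cross_smul_left (c : ℝ) (a b : E3) : cross (c • a) b = c • cross a b := by
  apply ext_three <;>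
  simp only [cross_zero, cross_one, cross_two, PiLp.smul_apply, smul_eq_mul] <;> ring

theorem cross_smul_right (c : ℝ) (a b : E3) : cross a (c • b) = c • cross a b := by
  apply ext_three <;>
  simp only [cross_zero, cross_one, cross_two, PiLp.smul_apply, smul_eq_mul] <;> ring

theorem cross_neg_right (a b : E3) : cross a (-b) = -cross a b := by
  simpa using cross_smul_right (-1) a b

theorem cross_self (a : E3) : cross a a = 0 := by
  apply ext_three <;> simp only [cross_zero, cross_one, cross_two, PiLp.zero_apply] <;> ring

theorem continuous_cross_right (a : E3) : Continuous (cross a) := by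
  unfold cross
  refine (PiLp.continuous_toLp 2 _).comp ?_
  have : Continuous (crossProduct (WithLp.ofLp a) : (Fin 3 → ℝ) → (Fin 3 → ℝ)) :=
    LinearMap.continuous_of_finiteDimensional _
  exact this.comp (PiLp.continuous_ofLp 2 _)

theorem hasDerivWithinAt_cross {f g : ℝ → E3} {f' g' : E3} {s : Set ℝ} {t : ℝ}
    (hf : HasDerivWithinAt f f' s t) (hg : HasDerivWithinAt g g' s t) :
    HasDerivWithinAt (fun τ => cross (f τ) (g τ)) (cross f' (g t) + cross (f t) g') s t := by
  have key : ∀ {h : ℝ → E3} {h' : E3}, HasDerivWithinAt h h' s t ↔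
      ∀ i, HasDerivWithinAt (fun τ => h τ i) (h' i) s t := fun {h h'} => by
    rw [hasDerivWithinAt_iff_hasFDerivWithinAt, hasFDerivWithinAt_euclidean]
    rfl
  rw [key] at hf hg ⊢
  intro i
  fin_cases i
  · simp only [Fin.zero_eta, cross_zero, PiLp.add_apply]
    refine (((hf 1).mul (hg 2)).sub ((hf 2).mul (hg 1))).congr_deriv ?_
    ring
  · simp only [Fin.mk_one, cross_one, PiLp.add_apply]
    refine (((hf 2).mul (hg 0)).sub ((hf 0).mul (hg 2))).congr_deriv ?_
    ring
  · simp only [Fin.reduceFinMk, cross_two, PiLp.add_apply]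
    refine (((hf 0).mul (hg 1)).sub ((hf 1).mul (hg 0))).congr_deriv ?_
    ring

end E3

/-! ### Angles and the moving frame of the orbital plane. -/

theorem HasDerivWithinAt.norm_of_ne_zero {E : Type*} [NormedAddCommGroup E] [InnerProductSpace ℝ E]
    {f : ℝ → E} {f' : E} {s : Set ℝ} {t : ℝ} (hf : HasDerivWithinAt f f' s t) (h0 : f t ≠ 0) :
    HasDerivWithinAt (fun τ => ‖f τ‖) (⟪f t, f'⟫ / ‖f t‖) s t := by
  have h1 := hf.norm_sq.sqrt (by simpa using h0)
  simp only [Real.sqrt_sq (norm_nonneg _)] at h1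
  refine h1.congr_deriv ?_
  field_simp

/-- The squared chord is `2 - 2 cos α`, and `cos α ≤ 1 - 2 α² / π²` on `[0, π]`. -/
theorem angle_le_mul_norm_sub {E : Type*} [NormedAddCommGroup E] [InnerProductSpace ℝ E] {x y : E}
    (hx : ‖x‖ = 1) (hy : ‖y‖ = 1) :
    InnerProductGeometry.angle x y ≤ Real.pi / 2 * ‖x - y‖ := by
  have h0 := InnerProductGeometry.angle_nonneg x y
  have h1 := InnerProductGeometry.angle_le_pi x y
  have hpi := Real.pi_pos
  have h2 := Real.cos_le_one_sub_mul_cos_sq (x := InnerProductGeometry.angle x y)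
    (by rwa [abs_of_nonneg h0])
  have h3 : ‖x - y‖ ^ 2 = 2 - 2 * Real.cos (InnerProductGeometry.angle x y) := by
    rw [@norm_sub_sq_real, InnerProductGeometry.cos_angle, hx, hy]; ring
  refine abs_le_of_sq_le_sq' ?_ (by positivity) |>.2
  rw [mul_pow, h3]
  have : InnerProductGeometry.angle x y ^ 2
      = (Real.pi / 2) ^ 2 * (2 * (2 / Real.pi ^ 2 * InnerProductGeometry.angle x y ^ 2)) := by
    field_simp
  rw [this]
  apply mul_le_mul_of_nonneg_left _ (by positivity)
  linarith

theorem norm_unitVec {x : E3} (hx : x ≠ 0) : ‖unitVec x‖ = 1 := by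
  rw [unitVec, norm_smul, norm_inv, norm_norm, inv_mul_cancel₀ (norm_ne_zero_iff.2 hx)]

/-- The unit vector orthogonal to `x` in the plane orthogonal to `J`. -/
noncomputable def transverseVec (J x : E3) : E3 := ‖J‖⁻¹ • E3.cross J (unitVec x)

/-- The unit vector making the angle `η` with `x` in the plane orthogonal to `J`. -/
noncomputable def polarVec (J x : E3) (η : ℝ) : E3 :=
  Real.cos η • unitVec x + Real.sin η • transverseVec J x

section Frame

variable {J x P : E3}

theorem inner_unitVec_transverseVec (J x : E3) : ⟪unitVec x, transverseVec J x⟫ = 0 := by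
  rw [transverseVec, inner_smul_right, real_inner_comm, E3.inner_cross_self_right, mul_zero]

theorem norm_transverseVec (hJ : J ≠ 0) (hx : x ≠ 0) (hJx : ⟪J, x⟫ = 0) :
    ‖transverseVec J x‖ = 1 := by
  have h : ‖E3.cross J (unitVec x)‖ ^ 2 = ‖J‖ ^ 2 := by
    rw [E3.norm_cross_sq, norm_unitVec hx, unitVec, inner_smul_right, hJx]; ring
  have h' : ‖E3.cross J (unitVec x)‖ = ‖J‖ := by
    rwa [sq_eq_sq₀ (norm_nonneg _) (norm_nonneg _)] at h
  rw [transverseVec, norm_smul, norm_inv, norm_norm, h', inv_mul_cancel₀ (norm_ne_zero_iff.2 hJ)]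

theorem norm_smul_add_smul_sq (hJ : J ≠ 0) (hx : x ≠ 0) (hJx : ⟪J, x⟫ = 0) (s t : ℝ) :
    ‖s • unitVec x + t • transverseVec J x‖ ^ 2 = s ^ 2 + t ^ 2 := by
  rw [norm_add_sq_real, norm_smul, norm_smul, norm_unitVec hx, norm_transverseVec hJ hx hJx,
    inner_smul_left, inner_smul_right, inner_unitVec_transverseVec]
  simp

theorem norm_polarVec (hJ : J ≠ 0) (hx : x ≠ 0) (hJx : ⟪J, x⟫ = 0) (η : ℝ) :
    ‖polarVec J x η‖ = 1 := by
  have h := norm_smul_add_smul_sq hJ hx hJx (Real.cos η) (Real.sin η)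
  rw [Real.cos_sq_add_sin_sq] at h
  rwa [polarVec, ← sq_eq_sq₀ (norm_nonneg _) zero_le_one, one_pow]

theorem angle_polarVec (hJ : J ≠ 0) (hx : x ≠ 0) (hJx : ⟪J, x⟫ = 0) {η : ℝ} (h0 : 0 ≤ η)
    (h1 : η ≤ Real.pi) : InnerProductGeometry.angle (polarVec J x η) (unitVec x) = η := by
  rw [InnerProductGeometry.angle, norm_polarVec hJ hx hJx, norm_unitVec hx, polarVec,
    inner_add_left, inner_smul_left, inner_smul_left, real_inner_self_eq_norm_sq, norm_unitVec hx,
    real_inner_comm, inner_unitVec_transverseVec]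
  simp [Real.arccos_cos h0 h1]

theorem norm_polarVec_sub_le (hJ : J ≠ 0) (hx : x ≠ 0) (hJx : ⟪J, x⟫ = 0) (η ξ : ℝ) :
    ‖polarVec J x η - polarVec J x ξ‖ ≤ 2 * |η - ξ| := by
  have h : polarVec J x η - polarVec J x ξ = (Real.cos η - Real.cos ξ) • unitVec x
      + (Real.sin η - Real.sin ξ) • transverseVec J x := by
    simp only [polarVec]; module
  rw [h]
  refine (norm_add_le _ _).trans ?_
  rw [norm_smul, norm_smul, norm_unitVec hx, norm_transverseVec hJ hx hJx, Real.norm_eq_abs,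
    Real.norm_eq_abs]
  have := Real.abs_cos_sub_cos_le η ξ
  have := Real.abs_sin_sub_sin_le η ξ
  linarith

theorem left_ne_zero_of_cross (h : E3.cross x P = J) (hJ : J ≠ 0) : x ≠ 0 := by
  rintro rfl
  apply hJ
  have := E3.cross_smul_left 0 0 P
  simp only [zero_smul] at this
  rw [← h, this]

theorem right_ne_zero_of_cross (h : E3.cross x P = J) (hJ : J ≠ 0) : P ≠ 0 := by
  rintro rfl
  apply hJ
  have := E3.cross_smul_right 0 x 0
  simp only [zero_smul] at this
  rw [← h, this]

theorem norm_cross_eq (x P : E3) :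
    ‖E3.cross x P‖ = ‖x‖ * ‖P‖ * Real.sin (InnerProductGeometry.angle x P) := by
  rw [← sq_eq_sq₀ (norm_nonneg _) (mul_nonneg (by positivity)
    (InnerProductGeometry.sin_angle_nonneg _ _)), E3.norm_cross_sq, mul_pow, Real.sin_sq,
    ← InnerProductGeometry.cos_angle_mul_norm_mul_norm]
  ring

/-- The component of `P` along `J × x` is positive because `J = x × P`, so the unoriented angle
between `x` and `P` is also the oriented one. -/
theorem unitVec_eq_polarVec (h : E3.cross x P = J) (hJ : J ≠ 0) :
    unitVec P = polarVec J x (InnerProductGeometry.angle x P) := by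
  have hx := left_ne_zero_of_cross h hJ
  have hP := right_ne_zero_of_cross h hJ
  have hx' := norm_ne_zero_iff.2 hx
  have hP' := norm_ne_zero_iff.2 hP
  have hJ' := norm_ne_zero_iff.2 hJ
  have hs : Real.sin (InnerProductGeometry.angle x P) = ‖J‖ / (‖x‖ * ‖P‖) := by
    rw [← h, norm_cross_eq]; field_simp
  rw [polarVec, hs, InnerProductGeometry.cos_angle, transverseVec, unitVec, unitVec,
    E3.cross_smul_right, smul_smul, smul_smul]
  rw [← h, E3.cross_cross_left, h]
  match_scalars
  · field_simp
  · field_simp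
    ring

end Frame

/-! ### Motion in a central field. -/

/-- The motion `x' = k P`, `P' = -k l x` in a central field, for `ζ ≤ σ`, with angular momentum
`J ≠ 0`. -/
structure CentralMotion (σ : ℝ) (k l : ℝ → ℝ) (x P : ℝ → E3) (J : E3) : Prop where
  pos : ∀ ζ ≤ σ, HasDerivWithinAt x (k ζ • P ζ) (Set.Iic σ) ζ
  mom : ∀ ζ ≤ σ, HasDerivWithinAt P (-(k ζ * l ζ) • x ζ) (Set.Iic σ) ζ
  ang : ∀ ζ ≤ σ, E3.cross (x ζ) (P ζ) = J
  ang_ne : J ≠ 0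

namespace CentralMotion

variable {σ : ℝ} {k l : ℝ → ℝ} {x P : ℝ → E3} {J : E3} (h : CentralMotion σ k l x P J)
include h

theorem pos_ne {ζ : ℝ} (hζ : ζ ≤ σ) : x ζ ≠ 0 := left_ne_zero_of_cross (h.ang ζ hζ) h.ang_ne

theorem mom_ne {ζ : ℝ} (hζ : ζ ≤ σ) : P ζ ≠ 0 := right_ne_zero_of_cross (h.ang ζ hζ) h.ang_ne

theorem inner_ang_pos {ζ : ℝ} (hζ : ζ ≤ σ) : ⟪J, x ζ⟫ = 0 := by
  rw [← h.ang ζ hζ, E3.inner_cross_self_left]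

theorem sin_angle {ζ : ℝ} (hζ : ζ ≤ σ) :
    Real.sin (InnerProductGeometry.angle (x ζ) (P ζ)) = ‖J‖ / (‖x ζ‖ * ‖P ζ‖) := by
  have hx' := norm_ne_zero_iff.2 (h.pos_ne hζ)
  have hP' := norm_ne_zero_iff.2 (h.mom_ne hζ)
  rw [← h.ang ζ hζ, norm_cross_eq]; field_simp

theorem hasDeriv_unitVec {ζ : ℝ} (hζ : ζ ≤ σ) :
    HasDerivWithinAt (fun τ => unitVec (x τ)) ((k ζ * ‖J‖ / ‖x ζ‖ ^ 2) • transverseVec J (x ζ))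
      (Set.Iic σ) ζ := by
  have hx := h.pos_ne hζ
  have hx' := norm_ne_zero_iff.2 hx
  have hJ' := norm_ne_zero_iff.2 h.ang_ne
  have hd := ((h.pos ζ hζ).norm_of_ne_zero hx).inv hx' |>.smul (h.pos ζ hζ)
  refine hd.congr_deriv ?_
  rw [transverseVec, unitVec, E3.cross_smul_right, ← h.ang ζ hζ, E3.cross_cross_left, h.ang ζ hζ,
    inner_smul_right]
  simp only [Pi.inv_apply]
  match_scalars <;> field_simp

theorem hasDeriv_transverseVec {ζ : ℝ} (hζ : ζ ≤ σ) :
    HasDerivWithinAt (fun τ => transverseVec J (x τ)) (-(k ζ * ‖J‖ / ‖x ζ‖ ^ 2) • unitVec (x ζ))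
      (Set.Iic σ) ζ := by
  have hJ' := norm_ne_zero_iff.2 h.ang_ne
  have hd := (E3.hasDerivWithinAt_cross (hasDerivWithinAt_const ζ (Set.Iic σ) J)
    (h.hasDeriv_unitVec hζ)).const_smul ‖J‖⁻¹
  refine hd.congr_deriv ?_
  have e0 : ∀ v : E3, E3.cross 0 v = 0 := fun v => by
    have := E3.cross_smul_left 0 0 v
    simpa using this
  rw [e0, zero_add, transverseVec, unitVec, E3.cross_smul_right, E3.cross_smul_right,
    E3.cross_smul_right, E3.cross_smul_right, E3.cross_cross_self, h.inner_ang_pos hζ]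
  have hx' := norm_ne_zero_iff.2 (h.pos_ne hζ)
  match_scalars <;> field_simp
  ring

/-- The frame itself turns at the rate `k |J| / |x|²`; a vector is fixed exactly when its angle in
the frame decreases at that rate. -/
theorem hasDeriv_polarVec {η : ℝ → ℝ} {η' ζ : ℝ} (hζ : ζ ≤ σ)
    (hη : HasDerivWithinAt η η' (Set.Iic σ) ζ) :
    HasDerivWithinAt (fun τ => polarVec J (x τ) (η τ))
      ((η' + k ζ * ‖J‖ / ‖x ζ‖ ^ 2) • (-Real.sin (η ζ) • unitVec (x ζ)
        + Real.cos (η ζ) • transverseVec J (x ζ))) (Set.Iic σ) ζ := by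
  have hd := (hη.cos.smul (h.hasDeriv_unitVec hζ)).add (hη.sin.smul (h.hasDeriv_transverseVec hζ))
  refine hd.congr_deriv ?_
  module

/-- Since `J ≠ 0`, `x` and `P` are never parallel: `1 - cos² = (|J| / (|x| |P|))² > 0`, so `arccos`
can be differentiated. For a light ray `l |x|² / |P|²` equals `u n' / n`. -/
theorem hasDeriv_angle {ζ : ℝ} (hζ : ζ ≤ σ) :
    HasDerivWithinAt (fun τ => InnerProductGeometry.angle (x τ) (P τ))
      (-(k ζ * ‖J‖ / ‖x ζ‖ ^ 2 * (1 - l ζ * ‖x ζ‖ ^ 2 / ‖P ζ‖ ^ 2))) (Set.Iic σ) ζ := by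
  have hx := h.pos_ne hζ
  have hP := h.mom_ne hζ
  have hx' := norm_pos_iff.2 hx
  have hP' := norm_pos_iff.2 hP
  have hJ' := norm_pos_iff.2 h.ang_ne
  have hJ2 : ‖J‖ ^ 2 = ‖x ζ‖ ^ 2 * ‖P ζ‖ ^ 2 - ⟪x ζ, P ζ⟫ ^ 2 := by
    rw [← h.ang ζ hζ, E3.norm_cross_sq]
  set c := ⟪x ζ, P ζ⟫ / (‖x ζ‖ * ‖P ζ‖) with hc
  have hc2 : 1 - c ^ 2 = (‖J‖ / (‖x ζ‖ * ‖P ζ‖)) ^ 2 := by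
    rw [hc, div_pow ‖J‖, hJ2]; field_simp
  have hpos : 0 < 1 - c ^ 2 := by rw [hc2]; positivity
  have hd := ((h.pos ζ hζ).inner ℝ (h.mom ζ hζ)).div
    (((h.pos ζ hζ).norm_of_ne_zero hx).mul ((h.mom ζ hζ).norm_of_ne_zero hP)) (mul_pos hx' hP').ne'
  have ha := (Real.hasDerivAt_arccos (x := c) (by rintro e; rw [e] at hpos; norm_num at hpos)
    (by rintro e; rw [e] at hpos; norm_num at hpos)).comp_hasDerivWithinAt ζ hd
  refine ha.congr_deriv ?_
  rw [hc2, Real.sqrt_sq (by positivity)]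
  simp only [inner_smul_left, inner_smul_right, real_inner_self_eq_norm_sq,
    real_inner_comm (x ζ) (P ζ)]
  simp only [conj_trivial, Pi.mul_apply]
  field_simp
  rw [hJ2]
  ring

end CentralMotion

/-! ### The approximate deflection and its comparison with the ray. -/

namespace StaticMetric

/-- The second order approximation of the deflection, as a function of `v = m / b` and of the
angle `ψ` between the radial direction and the ray. -/
noncomputable def approxDeflection (S : StaticMetric) (v ψ : ℝ) : ℝ :=
  (1 + S.γ) * v * (1 + Real.cos ψ)
    + v ^ 2 * (S.κ * (Real.pi - ψ + 1 / 2 * Real.sin (2 * ψ)))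

theorem approxDeflection_pi (S : StaticMetric) (v : ℝ) : S.approxDeflection v Real.pi = 0 := by
  simp [approxDeflection]

/-- The derivative involves `ψ` only through `v sin ψ`, which equals `u / n` along a ray and so
depends on the radius alone. -/
theorem hasDerivAt_approxDeflection (S : StaticMetric) (v ψ : ℝ) :
    HasDerivAt (S.approxDeflection v)
      (-((1 + S.γ) * (v * Real.sin ψ) + 2 * S.κ * (v * Real.sin ψ) ^ 2)) ψ := by
  have h1 := ((Real.hasDerivAt_cos ψ).const_add 1).const_mul ((1 + S.γ) * v)
  have h2 := (((hasDerivAt_id ψ).const_sub Real.pi).add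
    (((hasDerivAt_id ψ).const_mul 2).sin.const_mul (1 / 2))).const_mul S.κ |>.const_mul (v ^ 2)
  refine (h1.add h2).congr_deriv ?_
  simp only [id, Real.cos_two_mul, mul_one]
  linear_combination (2 * S.κ * v ^ 2) * Real.sin_sq_add_cos_sq ψ

end StaticMetric

theorem continuousOn_Icc_of_Iic {E : Type*} [NormedAddCommGroup E] [NormedSpace ℝ E] {f f' : ℝ → E}
    {σ : ℝ} (hf : ∀ ζ ≤ σ, HasDerivWithinAt f (f' ζ) (Set.Iic σ) ζ) (a : ℝ) :
    ContinuousOn f (Set.Icc a σ) :=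
  fun t ht => ((hf t ht.2).continuousWithinAt).mono Set.Icc_subset_Iic_self

theorem hasDerivAt_of_Iic {E : Type*} [NormedAddCommGroup E] [NormedSpace ℝ E] {f : ℝ → E} {f' : E}
    {σ ζ : ℝ} (hζ : ζ < σ) (hf : HasDerivWithinAt f f' (Set.Iic σ) ζ) : HasDerivAt f f' ζ :=
  hf.hasDerivAt (Iic_mem_nhds hζ)

theorem norm_sub_le_of_deriv_le {E : Type*} [NormedAddCommGroup E] [NormedSpace ℝ E]
    {f f' : ℝ → E} {g g' : ℝ → ℝ} {σ : ℝ}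
    (hf : ∀ ζ ≤ σ, HasDerivWithinAt f (f' ζ) (Set.Iic σ) ζ)
    (hg : ∀ ζ ≤ σ, HasDerivWithinAt g (g' ζ) (Set.Iic σ) ζ) {a : ℝ} (ha : a ≤ σ)
    (hle : ∀ ζ ∈ Set.Ico a σ, ‖f' ζ‖ ≤ g' ζ) : ‖f σ - f a‖ ≤ g σ - g a := by
  refine image_norm_le_of_norm_deriv_right_le_deriv_boundary' (f := fun t => f t - f a) (f' := f')
    (B := fun t => g t - g a) (B' := g') (a := a) (b := σ) ?_ ?_ (by simp) ?_ ?_ hle ⟨ha, le_rfl⟩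
  · exact (continuousOn_Icc_of_Iic hf a).sub continuousOn_const
  · intro t ht
    exact ((hasDerivAt_of_Iic ht.2 (hf t ht.2.le)).sub_const _).hasDerivWithinAt
  · exact (continuousOn_Icc_of_Iic hg a).sub continuousOn_const
  · intro t ht
    exact ((hasDerivAt_of_Iic ht.2 (hg t ht.2.le)).sub_const _).hasDerivWithinAt

namespace CentralMotion

variable {σ : ℝ} {k l : ℝ → ℝ} {x P : ℝ → E3} {J : E3}

/-- The angle is nonincreasing in `ζ`, hence has a limit at `-∞`; its sine `|J| / (|x| |P|)` tends
to `0`, so the limit is `0` or `π`. The value at `σ` is positive, which excludes `0`. -/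
theorem tendsto_angle_pi (h : CentralMotion σ k l x P J) (hk : ∀ ζ ≤ σ, 0 < k ζ)
    (hl : ∀ ζ ≤ σ, l ζ * ‖x ζ‖ ^ 2 / ‖P ζ‖ ^ 2 ≤ 1 / 2)
    (hinf : Tendsto (fun ζ => ‖x ζ‖) atBot atTop) (hP : ∀ ζ ≤ σ, 1 / 2 ≤ ‖P ζ‖) :
    Tendsto (fun ζ => InnerProductGeometry.angle (x ζ) (P ζ)) atBot (𝓝 Real.pi) := by
  set ψ := fun ζ => InnerProductGeometry.angle (x ζ) (P ζ) with hψ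
  have hanti : AntitoneOn ψ (Set.Iic σ) := by
    refine antitoneOn_of_hasDerivWithinAt_nonpos (convex_Iic σ)
      (fun t ht => (h.hasDeriv_angle ht).continuousWithinAt)
      (fun t ht => (h.hasDeriv_angle (Set.mem_Iic.1 (interior_subset ht))).mono interior_subset) fun t ht => ?_
    have ht : t ≤ σ := Set.mem_Iic.1 (interior_subset ht)
    have h1 := hk t ht
    have h2 := hl t ht
    have h3 : 0 ≤ 1 - l t * ‖x t‖ ^ 2 / ‖P t‖ ^ 2 := by linarith
    exact neg_nonpos.2 (mul_nonneg (by positivity) h3)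
  -- Truncation at `σ` gives a function antitone on the whole line with the same behaviour at `-∞`.
  have hanti' : Antitone fun ζ => ψ (min ζ σ) := fun a b hab =>
    hanti (Set.mem_Iic.2 (min_le_right _ _)) (Set.mem_Iic.2 (min_le_right _ _)) (min_le_min_right σ hab)
  have hlim := tendsto_atBot_ciSup hanti' ⟨Real.pi, by
    rintro _ ⟨t, rfl⟩; exact InnerProductGeometry.angle_le_pi _ _⟩
  set L := ⨆ ζ, ψ (min ζ σ)
  have hev : (fun ζ => ψ (min ζ σ)) =ᶠ[atBot] ψ := by
    filter_upwards [eventually_le_atBot σ] with t ht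
    rw [min_eq_left ht]
  have hlim' : Tendsto ψ atBot (𝓝 L) := hlim.congr' hev
  have hJ := norm_pos_iff.2 h.ang_ne
  have hσ : 0 < ψ σ := by
    have h1 := h.sin_angle le_rfl
    have h2 := norm_pos_iff.2 (h.pos_ne le_rfl)
    have h3 := norm_pos_iff.2 (h.mom_ne le_rfl)
    have h4 : 0 < Real.sin (InnerProductGeometry.angle (x σ) (P σ)) := by rw [h1]; positivity
    refine lt_of_le_of_ne (InnerProductGeometry.angle_nonneg _ _) fun h5 => ?_
    simp only [hψ] at h5
    rw [← h5, Real.sin_zero] at h4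
    exact lt_irrefl _ h4
  have hL1 : ψ σ ≤ L := ge_of_tendsto hlim' (by
    filter_upwards [eventually_le_atBot σ] with t ht using hanti ht (Set.mem_Iic.2 le_rfl) ht)
  have hL2 : L ≤ Real.pi := le_of_tendsto' hlim' fun t => InnerProductGeometry.angle_le_pi _ _
  have hsin : Tendsto (fun ζ => Real.sin (ψ ζ)) atBot (𝓝 0) := by
    refine squeeze_zero' (Eventually.of_forall fun t => InnerProductGeometry.sin_angle_nonneg _ _)
      ?_ ((hinf.const_div_atTop (2 * ‖J‖)))
    filter_upwards [eventually_le_atBot σ] with t ht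
    simp only [hψ]
    have h2 := norm_pos_iff.2 (h.pos_ne ht)
    have h3 := hP t ht
    rw [h.sin_angle ht, div_le_div_iff₀ (by positivity) h2]
    nlinarith [mul_pos hJ h2]
  have hsL := tendsto_nhds_unique ((Real.continuous_sin.tendsto L).comp hlim') hsin
  have : L = Real.pi := by
    by_contra hne
    have := Real.sin_pos_of_pos_of_lt_pi (hσ.trans_le hL1) (lt_of_le_of_ne hL2 hne)
    exact this.ne' hsL
  rwa [this] at hlim'

/-- The speed of the corrected direction is at most `16 K v³` times `-ψ'`. Integration from `-∞`
bounds its variation by `16 K v³ π`, without any estimate of the orbit. -/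
theorem norm_polarVec_sub_direction_le (h : CentralMotion σ k l x P J) (S : StaticMetric)
    {δ K m : ℝ} {N : E3} (hK : 0 < K) (hweak : ∀ u, 0 < u → u < δ → S.WeakField K u) (hm : 0 < m)
    (hu : ∀ ζ ≤ σ, m / ‖x ζ‖ < δ) (hk : ∀ ζ ≤ σ, 0 < k ζ)
    (hn : ∀ ζ ≤ σ, ‖P ζ‖ = S.index (m / ‖x ζ‖))
    (hl : ∀ ζ ≤ σ, l ζ * ‖x ζ‖ ^ 2
      = m / ‖x ζ‖ * S.index (m / ‖x ζ‖) * deriv S.index (m / ‖x ζ‖))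
    (hinf : Tendsto (fun ζ => ‖x ζ‖) atBot atTop)
    (hdir : Tendsto (fun ζ => unitVec (P ζ)) atBot (𝓝 N)) :
    ‖polarVec J (x σ) (InnerProductGeometry.angle (x σ) (P σ)
      - S.approxDeflection (m / ‖J‖) (InnerProductGeometry.angle (x σ) (P σ))) - N‖
      ≤ 16 * K * Real.pi * (m / ‖J‖) ^ 3 := by
  set ψ := fun ζ => InnerProductGeometry.angle (x ζ) (P ζ) with hψ
  set v := m / ‖J‖ with hv
  have hJ := norm_pos_iff.2 h.ang_ne
  have hx : ∀ ζ ≤ σ, 0 < ‖x ζ‖ := fun ζ hζ => norm_pos_iff.2 (h.pos_ne hζ)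
  have hW : ∀ ζ ≤ σ, S.WeakField K (m / ‖x ζ‖) := fun ζ hζ =>
    hweak _ (div_pos hm (hx ζ hζ)) (hu ζ hζ)
  have hlN : ∀ ζ ≤ σ, l ζ * ‖x ζ‖ ^ 2 / ‖P ζ‖ ^ 2
      = m / ‖x ζ‖ * deriv S.index (m / ‖x ζ‖) / S.index (m / ‖x ζ‖) := fun ζ hζ => by
    have := (hW ζ hζ).index_ge
    rw [hl ζ hζ, hn ζ hζ]
    field_simp
  have hpi := h.tendsto_angle_pi hk
    (fun ζ hζ => by rw [hlN ζ hζ]; exact (hW ζ hζ).slope_le) hinf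
    (fun ζ hζ => by rw [hn ζ hζ]; exact (hW ζ hζ).index_ge)
  set w := fun ζ => polarVec J (x ζ) (ψ ζ - S.approxDeflection v (ψ ζ)) with hw
  -- Far away the corrected direction and that of `P` differ by an angle `Φ(ψ) → Φ(π) = 0`.
  have hwlim : Tendsto w atBot (𝓝 N) := by
    have hΦ : Tendsto (fun ζ => 2 * |S.approxDeflection v (ψ ζ)|) atBot (𝓝 0) := by
      have h1 := ((S.hasDerivAt_approxDeflection v Real.pi).continuousAt.tendsto.comp hpi).abs
      simpa [S.approxDeflection_pi] using h1.const_mul 2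
    have h2 : Tendsto (fun ζ => w ζ - unitVec (P ζ)) atBot (𝓝 0) := by
      refine squeeze_zero_norm' ?_ hΦ
      filter_upwards [eventually_le_atBot σ] with ζ hζ
      rw [unitVec_eq_polarVec (h.ang ζ hζ) h.ang_ne]
      refine (norm_polarVec_sub_le h.ang_ne (h.pos_ne hζ) (h.inner_ang_pos hζ) _ _).trans
        (le_of_eq ?_)
      rw [sub_sub_cancel_left, abs_neg]
    simpa using h2.add hdir
  have hder : ∀ ζ ≤ σ, HasDerivWithinAt w _ (Set.Iic σ) ζ := fun ζ hζ =>
    h.hasDeriv_polarVec hζ ((h.hasDeriv_angle hζ).sub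
      ((S.hasDerivAt_approxDeflection v (ψ ζ)).comp_hasDerivWithinAt ζ (h.hasDeriv_angle hζ)))
  have hψd : ∀ ζ ≤ σ, HasDerivWithinAt (fun t => -(16 * K * v ^ 3) * ψ t) _ (Set.Iic σ) ζ :=
    fun ζ hζ => (h.hasDeriv_angle hζ).const_mul (-(16 * K * v ^ 3))
  have hbound : ∀ a ≤ σ, ‖w σ - w a‖ ≤ 16 * K * Real.pi * v ^ 3 := by
    intro a ha
    refine (norm_sub_le_of_deriv_le hder hψd ha ?_).trans ?_
    · intro ζ hζ
      have hζ := hζ.2.le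
      rw [norm_smul]
      have hfr : ‖-Real.sin (ψ ζ - S.approxDeflection v (ψ ζ)) • unitVec (x ζ)
          + Real.cos (ψ ζ - S.approxDeflection v (ψ ζ)) • transverseVec J (x ζ)‖ = 1 := by
        rw [← sq_eq_sq₀ (norm_nonneg _) zero_le_one,
          norm_smul_add_smul_sq h.ang_ne (h.pos_ne hζ) (h.inner_ang_pos hζ), neg_sq,
          Real.sin_sq_add_cos_sq, one_pow]
      rw [hfr, mul_one, Real.norm_eq_abs, hlN ζ hζ]
      have hWζ := hW ζ hζ
      set u := m / ‖x ζ‖ with hu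
      have hN1 := hWζ.index_ge
      have hxζ := hx ζ hζ
      have hu0 : 0 < u := div_pos hm hxζ
      have hvs : v * Real.sin (ψ ζ) = u / S.index u := by
        simp only [hψ]
        rw [h.sin_angle hζ, hn ζ hζ, hv, ← hu, hu]
        field_simp
      set θ := k ζ * ‖J‖ / ‖x ζ‖ ^ 2 with hθ
      have hθ0 : 0 < θ := by have := hk ζ hζ; positivity
      rw [hvs]
      -- Here `u / n = v sin ψ ≤ v` and `n ≤ 2`.
      have huv : u ≤ 2 * v := by
        have h1 := InnerProductGeometry.angle_nonneg (x ζ) (P ζ)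
        have h2 := Real.sin_le_one (ψ ζ)
        have hv0 : 0 < v := by positivity
        have h3 : u / S.index u ≤ v := by rw [← hvs]; nlinarith
        rw [div_le_iff₀ (by linarith)] at h3
        nlinarith [hWζ.index_le]
      have e : -(θ * (1 - u * deriv S.index u / S.index u))
          - -((1 + S.γ) * (u / S.index u) + 2 * S.κ * (u / S.index u) ^ 2)
            * -(θ * (1 - u * deriv S.index u / S.index u)) + θ = θ * S.defect u := by
        rw [StaticMetric.defect]; ring
      rw [e, abs_mul, abs_of_pos hθ0]
      have h1 := hWζ.slope_le
      have h2 := hWζ.defect_le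
      have h3 : u ^ 3 ≤ 8 * v ^ 3 := by
        have := pow_le_pow_left₀ hu0.le huv 3
        linarith [mul_pow 2 v 3]
      have h4 : |S.defect u| ≤ 8 * K * v ^ 3 := by nlinarith
      have hv0 : 0 < v := by positivity
      have h5 : 0 < K * v ^ 3 := by positivity
      -- The factor 8 is the cube in `u ≤ 2 v`; the remaining 2 comes from `1 - u n' / n ≥ 1 / 2`,
      -- which bounds `θ` by `-2 ψ'`.
      calc θ * |S.defect u| ≤ θ * (8 * K * v ^ 3) := mul_le_mul_of_nonneg_left h4 hθ0.le
        _ = 16 * K * v ^ 3 * (θ * (1 / 2)) := by ring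
        _ ≤ 16 * K * v ^ 3 * (θ * (1 - u * deriv S.index u / S.index u)) := by
          apply mul_le_mul_of_nonneg_left _ (by positivity)
          apply mul_le_mul_of_nonneg_left _ hθ0.le
          linarith
        _ = _ := by ring
    · have h1 := InnerProductGeometry.angle_nonneg (x σ) (P σ)
      have h2 := InnerProductGeometry.angle_le_pi (x a) (P a)
      have h5 : 0 < 16 * K * v ^ 3 := by positivity
      have : 16 * K * v ^ 3 * (ψ a - ψ σ) ≤ 16 * K * v ^ 3 * Real.pi :=
        mul_le_mul_of_nonneg_left (by simp only [hψ]; linarith) h5.le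
      linarith
  have hlim : Tendsto (fun a => ‖w σ - w a‖) atBot (𝓝 ‖w σ - N‖) :=
    (tendsto_const_nhds.sub hwlim).norm
  exact le_of_tendsto hlim (by filter_upwards [eventually_le_atBot σ] with a ha using hbound a ha)

end CentralMotion

/-! ### Light paths as central motions. -/

/-- The normalized covariant momentum `-(l_i / l_0)` along a path. -/
noncomputable def SpacetimePath.momentum (p : SpacetimePath) (S : StaticMetric) (m ζ : ℝ) : E3 :=
  -S.directionTriple m (p.pos ζ) (p.tangent ζ)

theorem StaticMetric.impactParameter_eq (S : StaticMetric) (m ζ : ℝ) (p : SpacetimePath) :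
    S.impactParameter m (p.pos ζ) (p.tangent ζ) = ‖E3.cross (p.pos ζ) (p.momentum S m ζ)‖ := by
  rw [StaticMetric.impactParameter, SpacetimePath.momentum, E3.cross_neg_right]

theorem StaticMetric.deriv_A {S : StaticMetric} {m r : ℝ} (hr : r ≠ 0)
    (h : DifferentiableAt ℝ S.serA (m / r)) :
    deriv (S.A m) r = -(m / r ^ 2 * deriv S.serA (m / r)) := by
  have h1 := HasDerivAt.comp (h := fun y => m * y⁻¹) r
    (by simpa only [div_eq_mul_inv] using h.hasDerivAt) ((hasDerivAt_inv hr).const_mul m)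
  have h2 : S.A m = S.serA ∘ fun y => m * y⁻¹ := by
    funext y; simp [StaticMetric.A, StaticMetric.serA, div_eq_mul_inv]
  rw [h2, h1.deriv]
  field_simp

theorem StaticMetric.deriv_W {S : StaticMetric} {m r : ℝ} (hr : r ≠ 0)
    (h : DifferentiableAt ℝ S.serW (m / r)) :
    deriv (S.W m) r = -(m / r ^ 2 * deriv S.serW (m / r)) := by
  have h1 := HasDerivAt.comp (h := fun y => m * y⁻¹) r
    (by simpa only [div_eq_mul_inv] using h.hasDerivAt) ((hasDerivAt_inv hr).const_mul m)
  have h2 : S.W m = S.serW ∘ fun y => m * y⁻¹ := by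
    funext y; simp [StaticMetric.W, StaticMetric.serW, div_eq_mul_inv]
  rw [h2, h1.deriv]
  field_simp

namespace IsLightPath

variable {S : StaticMetric} {m σ : ℝ} {p : SpacetimePath}

section

variable (h : IsLightPath S m σ p) (hm : 0 < m) {ζ : ℝ} (hζ : ζ ≤ σ)
include h hm hζ

theorem norm_pos_pos : 0 < ‖p.pos ζ‖ :=
  (mul_pos S.ρ_pos hm).trans (h.exterior ζ hζ)

theorem ratio_mem : 0 < m / ‖p.pos ζ‖ ∧ S.ρ * (m / ‖p.pos ζ‖) < 1 := by
  have h0 := h.norm_pos_pos hm hζ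
  refine ⟨by positivity, ?_⟩
  rw [← mul_div_assoc, div_lt_one h0]
  exact h.exterior ζ hζ

theorem A_pos : 0 < S.A m ‖p.pos ζ‖ :=
  S.posA _ (h.ratio_mem hm hζ).1 (h.ratio_mem hm hζ).2

theorem W_pos : 0 < S.W m ‖p.pos ζ‖ :=
  S.posW _ (h.ratio_mem hm hζ).1 (h.ratio_mem hm hζ).2

omit hm in
theorem null_eq : S.W m ‖p.pos ζ‖ * ‖p.vel ζ‖ ^ 2 = S.A m ‖p.pos ζ‖ * p.timeVel ζ ^ 2 := by
  have := h.null ζ hζ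
  simp only [StaticMetric.lor, SpacetimePath.tangent, real_inner_self_eq_norm_sq] at this
  linarith

theorem vel_ne : p.vel ζ ≠ 0 := by
  intro h0
  have h1 := h.null_eq hζ
  have h2 := h.A_pos hm hζ
  have h3 := h.future ζ hζ
  rw [h0] at h1
  have : 0 < S.A m ‖p.pos ζ‖ * p.timeVel ζ ^ 2 := by positivity
  simp at h1
  rcases h1 with h1 | h1 <;> linarith

omit hm in
theorem energy_eq :
    S.A m ‖p.pos ζ‖ * p.timeVel ζ = S.A m ‖p.pos σ‖ * p.timeVel σ := by
  have := norm_sub_le_of_deriv_le (f' := fun _ => (0 : ℝ)) (g := fun _ => (0 : ℝ)) (g' := fun _ => 0)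
    h.geodesic_time (fun t _ => hasDerivWithinAt_const _ _ _) hζ (by simp)
  simp only [sub_self, norm_le_zero_iff, sub_eq_zero] at this
  exact this.symm

omit hm in
theorem momentum_eq : p.momentum S m ζ
    = ((S.A m ‖p.pos σ‖ * p.timeVel σ)⁻¹ * S.W m ‖p.pos ζ‖) • p.vel ζ := by
  rw [SpacetimePath.momentum, StaticMetric.directionTriple, SpacetimePath.tangent]
  simp only
  rw [h.energy_eq hζ, smul_neg, neg_neg, smul_smul]

omit hζ in
theorem energy_pos : 0 < S.A m ‖p.pos σ‖ * p.timeVel σ :=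
  mul_pos (h.A_pos hm le_rfl) (h.future σ le_rfl)

theorem norm_momentum : ‖p.momentum S m ζ‖ = S.index (m / ‖p.pos ζ‖) := by
  have hA := h.A_pos hm hζ
  have hW := h.W_pos hm hζ
  have hE := h.energy_pos hm
  have ht := h.future ζ hζ
  have hn := h.null_eq hζ
  rw [h.momentum_eq hζ, norm_smul, Real.norm_eq_abs, abs_of_pos (by positivity)]
  rw [← h.energy_eq hζ]
  have hA' := hA.ne'
  have ht' := ht.ne'
  have e : S.W m ‖p.pos ζ‖ / S.A m ‖p.pos ζ‖
      = ((S.A m ‖p.pos ζ‖ * p.timeVel ζ)⁻¹ * S.W m ‖p.pos ζ‖ * ‖p.vel ζ‖) ^ 2 := by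
    rw [mul_pow, mul_pow]
    field_simp
    linear_combination -hn
  change _ = √(S.W m ‖p.pos ζ‖ / S.A m ‖p.pos ζ‖)
  rw [e, Real.sqrt_sq (by positivity)]

theorem unitVec_momentum : unitVec (p.momentum S m ζ) = unitVec (p.vel ζ) := by
  have hW := h.W_pos hm hζ
  have hE := h.energy_pos hm
  have hv := norm_pos_iff.2 (h.vel_ne hm hζ)
  rw [h.momentum_eq hζ, unitVec, unitVec, norm_smul, Real.norm_eq_abs,
    abs_of_pos (by positivity), smul_smul]
  congr 1
  set e := S.A m ‖p.pos σ‖ * p.timeVel σ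
  field_simp

theorem angle_momentum (y : E3) :
    InnerProductGeometry.angle y (p.momentum S m ζ) = InnerProductGeometry.angle y (p.vel ζ) := by
  have hW := h.W_pos hm hζ
  have hE := h.energy_pos hm
  rw [h.momentum_eq hζ, InnerProductGeometry.angle_smul_right_of_pos]
  positivity

end

theorem hasDeriv_momentum (h : IsLightPath S m σ p) {ζ : ℝ} (hζ : ζ ≤ σ) :
    HasDerivWithinAt (p.momentum S m)
      (-((S.A m ‖p.pos σ‖ * p.timeVel σ)⁻¹ * (1 / 2 * (deriv (S.A m) ‖p.pos ζ‖ * p.timeVel ζ ^ 2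
          - deriv (S.W m) ‖p.pos ζ‖ * ‖p.vel ζ‖ ^ 2)) / ‖p.pos ζ‖) • p.pos ζ) (Set.Iic σ) ζ := by
  have h1 := (h.geodesic_pos ζ hζ).const_smul (-(S.A m ‖p.pos σ‖ * p.timeVel σ)⁻¹)
  have h2 : Set.EqOn (p.momentum S m) (-(S.A m ‖p.pos σ‖ * p.timeVel σ)⁻¹
      • fun τ => -(S.W m ‖p.pos τ‖ • p.vel τ)) (Set.Iic σ) := fun t ht => by
    rw [h.momentum_eq ht]
    simp [smul_smul]
  refine (h1.congr h2 (h2 hζ)).congr_deriv ?_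
  module

/-- Momentum is parallel to velocity and force is parallel to position, so both terms of the
derivative vanish. -/
theorem angularMomentum_eq (h : IsLightPath S m σ p) {ζ : ℝ} (hζ : ζ ≤ σ) :
    E3.cross (p.pos ζ) (p.momentum S m ζ) = E3.cross (p.pos σ) (p.momentum S m σ) := by
  have hd : ∀ t ≤ σ, HasDerivWithinAt (fun τ => E3.cross (p.pos τ) (p.momentum S m τ)) 0
      (Set.Iic σ) t := fun t ht => by
    refine (E3.hasDerivWithinAt_cross (h.hasDeriv_pos t ht)
      (h.hasDeriv_momentum ht)).congr_deriv ?_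
    rw [h.momentum_eq ht, E3.cross_smul_right, E3.cross_smul_right, E3.cross_self,
      E3.cross_self, smul_zero, smul_zero, add_zero]
  have := norm_sub_le_of_deriv_le hd (g := fun _ => (0 : ℝ)) (g' := fun _ => 0)
    (fun t _ => hasDerivWithinAt_const _ _ _) hζ (by simp)
  simp only [sub_self, norm_le_zero_iff, sub_eq_zero] at this
  exact this.symm

theorem centralMotion (h : IsLightPath S m σ p) (hm : 0 < m) {J : E3}
    (hJ : E3.cross (p.pos σ) (p.momentum S m σ) = J) (hJ0 : J ≠ 0) :
    CentralMotion σ (fun ζ => S.A m ‖p.pos σ‖ * p.timeVel σ / S.W m ‖p.pos ζ‖)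
      (fun ζ => S.W m ‖p.pos ζ‖ * (deriv (S.A m) ‖p.pos ζ‖ * p.timeVel ζ ^ 2
        - deriv (S.W m) ‖p.pos ζ‖ * ‖p.vel ζ‖ ^ 2)
        / (2 * (S.A m ‖p.pos σ‖ * p.timeVel σ) ^ 2 * ‖p.pos ζ‖))
      p.pos (p.momentum S m) J where
  pos ζ hζ := by
    refine (h.hasDeriv_pos ζ hζ).congr_deriv ?_
    have hW := h.W_pos hm hζ
    have hE := h.energy_pos hm
    rw [h.momentum_eq hζ, smul_smul]
    have : S.A m ‖p.pos σ‖ * p.timeVel σ / S.W m ‖p.pos ζ‖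
        * ((S.A m ‖p.pos σ‖ * p.timeVel σ)⁻¹ * S.W m ‖p.pos ζ‖) = 1 := by
      set e := S.A m ‖p.pos σ‖ * p.timeVel σ
      field_simp
    rw [this, one_smul]
  mom ζ hζ := by
    refine (h.hasDeriv_momentum hζ).congr_deriv ?_
    have hW := h.W_pos hm hζ
    have hE := h.energy_pos hm
    have hr := h.norm_pos_pos hm hζ
    congr 2
    set e := S.A m ‖p.pos σ‖ * p.timeVel σ
    field_simp
  ang ζ hζ := (h.angularMomentum_eq hζ).trans hJ
  ang_ne := hJ0

/-- The null condition eliminates the spatial speed, and the derivative of `index² * serA = serW`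
turns the metric force into that of the optical medium. -/
theorem force_eq (h : IsLightPath S m σ p) (hm : 0 < m) {K ζ : ℝ} (hζ : ζ ≤ σ)
    (hw : S.WeakField K (m / ‖p.pos ζ‖)) :
    S.W m ‖p.pos ζ‖ * (deriv (S.A m) ‖p.pos ζ‖ * p.timeVel ζ ^ 2
        - deriv (S.W m) ‖p.pos ζ‖ * ‖p.vel ζ‖ ^ 2)
        / (2 * (S.A m ‖p.pos σ‖ * p.timeVel σ) ^ 2 * ‖p.pos ζ‖) * ‖p.pos ζ‖ ^ 2
      = m / ‖p.pos ζ‖ * S.index (m / ‖p.pos ζ‖) * deriv S.index (m / ‖p.pos ζ‖) := by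
  have hA := h.A_pos hm hζ
  have hW := h.W_pos hm hζ
  have ht := h.future ζ hζ
  have hr := h.norm_pos_pos hm hζ
  have hn := h.null_eq hζ
  have hi := hw.index_deriv
  rw [StaticMetric.deriv_A hr.ne' hw.diffA, StaticMetric.deriv_W hr.ne' hw.diffW,
    ← h.energy_eq hζ]
  change 2 * _ * _ * S.A m ‖p.pos ζ‖ ^ 2 = _ * S.A m ‖p.pos ζ‖ - S.W m ‖p.pos ζ‖ * _ at hi
  set a := S.A m ‖p.pos ζ‖
  set w := S.W m ‖p.pos ζ‖
  set a' := deriv S.serA (m / ‖p.pos ζ‖)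
  set w' := deriv S.serW (m / ‖p.pos ζ‖)
  set n := S.index (m / ‖p.pos ζ‖)
  set n' := deriv S.index (m / ‖p.pos ζ‖)
  field_simp
  linear_combination w' * hn - p.timeVel ζ ^ 2 * hi

end IsLightPath

/-! ### A priori control of light paths. -/

theorem hasDerivWithinAt_reverse {E : Type*} [NormedAddCommGroup E] [NormedSpace ℝ E] {f f' : ℝ → E}
    {σ : ℝ} (hf : ∀ ζ ≤ σ, HasDerivWithinAt f (f' ζ) (Set.Iic σ) ζ) {τ : ℝ} (hτ : 0 ≤ τ) :
    HasDerivWithinAt (fun t => f (σ - t)) (-f' (σ - τ)) (Set.Ici 0) τ := by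
  have h1 : HasDerivWithinAt (fun t : ℝ => σ - t) (-1) (Set.Ici 0) τ :=
    ((hasDerivAt_id τ).const_sub σ).hasDerivWithinAt
  have h2 := (hf (σ - τ) (by linarith)).scomp τ h1
    (fun t (ht : 0 ≤ t) => Set.mem_Iic.2 (by linarith))
  exact h2.congr_deriv (by simp)

namespace IsLightPath

variable {S : StaticMetric} {m σ δ K : ℝ} {p : SpacetimePath}

/-- A ray whose angular momentum is large compared with `m` stays in the weak field region. -/
theorem ratio_lt (h : IsLightPath S m σ p) (hm : 0 < m) (hδ : 0 < δ)
    (hweak : ∀ u, 0 < u → u < δ → S.WeakField K u) (hσ : m / ‖p.pos σ‖ < δ)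
    (hb : 2 * m / δ < ‖E3.cross (p.pos σ) (p.momentum S m σ)‖) {ζ : ℝ} (hζ : ζ ≤ σ) :
    m / ‖p.pos ζ‖ < δ := by
  set b := ‖E3.cross (p.pos σ) (p.momentum S m σ)‖
  -- In the weak field `b ≤ |x| |P| ≤ 2 |x|`.
  have hbr : ∀ t ≤ σ, m / ‖p.pos t‖ < δ → b ≤ 2 * ‖p.pos t‖ := fun t ht hlt => by
    have h1 := (hweak _ (h.ratio_mem hm ht).1 hlt).index_le
    have h2 : ‖E3.cross (p.pos t) (p.momentum S m t)‖ ≤ ‖p.pos t‖ * ‖p.momentum S m t‖ := by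
      rw [norm_cross_eq]
      exact mul_le_of_le_one_right (by positivity) (Real.sin_le_one _)
    rw [h.angularMomentum_eq ht, h.norm_momentum hm ht] at h2
    nlinarith [h.norm_pos_pos hm ht]
  by_contra hcon
  have hr := h.norm_pos_pos hm hζ
  rw [not_lt, le_div_iff₀ hr] at hcon
  have h1 : ‖p.pos ζ‖ ≤ m / δ := by rw [le_div_iff₀ hδ]; linarith
  have h2 := hbr σ le_rfl hσ
  have e : 2 * m / δ = 2 * (m / δ) := by ring
  have h3 : m / δ < b / 2 := by linarith
  have hcont : ContinuousOn (fun t => ‖p.pos t‖) (Set.Icc ζ σ) :=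
    (continuousOn_Icc_of_Iic h.hasDeriv_pos ζ).norm
  -- By continuity the radius would equal the midpoint of `m / δ` and `b / 2`: large enough for the
  -- weak field, yet less than `b / 2`.
  obtain ⟨t, ht, hte⟩ := intermediate_value_Icc hζ hcont
    (show (m / δ + b / 2) / 2 ∈ Set.Icc ‖p.pos ζ‖ ‖p.pos σ‖ from ⟨by linarith, by linarith⟩)
  simp only at hte
  have hpos : 0 < m / δ := by positivity
  have h4 := hbr t ht.2 (by
    rw [hte, div_lt_iff₀ (by linarith)]
    have : m = δ * (m / δ) := by field_simp
    nlinarith)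
  rw [hte] at h4
  linarith

theorem speed_le (h : IsLightPath S m σ p) {ζ : ℝ} (hζ : ζ ≤ σ)
    (hw : S.WeakField K (m / ‖p.pos ζ‖)) : ‖p.vel ζ‖ ≤ 2 * p.timeVel ζ := by
  have hn := h.null_eq hζ
  have ht := h.future ζ hζ
  have h1 : S.A m ‖p.pos ζ‖ ≤ 2 := hw.serA_le
  have h2 : 1 / 2 ≤ S.W m ‖p.pos ζ‖ := hw.serW_ge
  refine abs_le_of_sq_le_sq' ?_ (by positivity) |>.2
  nlinarith [sq_nonneg ‖p.vel ζ‖, sq_nonneg (p.timeVel ζ)]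

theorem time_le (h : IsLightPath S m σ p) {a c : ℝ} (hac : a ≤ c) (hc : c ≤ σ) :
    p.time a ≤ p.time c := by
  have := norm_sub_le_of_deriv_le (σ := c) (f := fun _ => (0 : ℝ)) (f' := fun _ => 0)
    (g := p.time) (g' := p.timeVel) (fun t _ => hasDerivWithinAt_const _ _ _)
    (fun t ht => (h.hasDeriv_time t (ht.trans hc)).mono (Set.Iic_subset_Iic.2 hc)) hac
    (fun t ht => by simpa using (h.future t (ht.2.le.trans hc)).le)
  simp at this
  exact this

/-- Over a short interval of coordinate time the ray stays away from the centre. -/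
theorem half_le_norm (h : IsLightPath S m σ p) (hm : 0 < m)
    (hweak : ∀ u, 0 < u → u < δ → S.WeakField K u) {R s : ℝ} (hR : 0 < R)
    (hRm : 2 * m / R < δ) (hpos : ‖p.pos σ‖ = R)
    (htime : 6 * (p.time σ - p.time (σ - s)) ≤ R) {ζ : ℝ} (hζ : ζ ∈ Set.Icc (σ - s) σ) :
    R / 2 ≤ ‖p.pos ζ‖ := by
  have hfd := fun (τ : ℝ) (hτ : 0 ≤ τ) => hasDerivWithinAt_reverse h.hasDeriv_pos hτ
  have hBd := fun (τ : ℝ) (hτ : 0 ≤ τ) => hasDerivWithinAt_reverse h.hasDeriv_time hτ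
  have mono : ∀ τ, 0 ≤ τ → τ ≤ s → p.time (σ - s) ≤ p.time (σ - τ) := fun τ h0 hτ =>
    h.time_le (by linarith) (by linarith)
  -- The speed bound is needed only where the displacement equals three times the elapsed time.
  -- There it is at most `R / 2`, so the point lies in the weak field and the speed is at most `2 *
  -- timeVel`, strictly below the slope `3 * timeVel`.
  have key := image_norm_le_of_norm_deriv_right_lt_deriv_boundary' (a := 0) (b := s)
    (f := fun τ => p.pos (σ - τ) - p.pos σ) (f' := fun τ => -p.vel (σ - τ))
    (B := fun τ => 3 * (p.time σ - p.time (σ - τ))) (B' := fun τ => 3 * p.timeVel (σ - τ))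
    (fun τ hτ => ((hfd τ hτ.1).continuousWithinAt.mono Set.Icc_subset_Ici_self).sub
      continuousWithinAt_const)
    (fun τ hτ => ((hfd τ hτ.1).mono (Set.Ici_subset_Ici.2 hτ.1)).sub_const _) (by simp)
    (fun τ hτ => continuousWithinAt_const.mul (continuousWithinAt_const.sub
      ((hBd τ hτ.1).continuousWithinAt.mono Set.Icc_subset_Ici_self)))
    (fun τ hτ => (((hBd τ hτ.1).mono (Set.Ici_subset_Ici.2 hτ.1)).const_sub _ |>.const_mul 3
      ).congr_deriv (by simp))
    (fun τ hτ hEq => by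
      have h1 := mono τ hτ.1 hτ.2.le
      have h2 : σ - τ ≤ σ := by linarith [hτ.1]
      have h3 : R ≤ ‖p.pos (σ - τ)‖ + ‖p.pos (σ - τ) - p.pos σ‖ := by
        rw [← hpos]
        have := norm_sub_le (p.pos (σ - τ)) (p.pos (σ - τ) - p.pos σ)
        simpa using this
      rw [hEq] at h3
      have hr := h.norm_pos_pos hm h2
      have h4 : m / ‖p.pos (σ - τ)‖ ≤ 2 * m / R := by
        rw [div_le_div_iff₀ hr hR]
        nlinarith
      have h5 := h.speed_le h2 (hweak _ (h.ratio_mem hm h2).1 (h4.trans_lt hRm))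
      rw [norm_neg]
      linarith [h.future _ h2])
  have h1 := key (x := σ - ζ) ⟨by linarith [hζ.2], by linarith [hζ.1]⟩
  have h2 := mono (σ - ζ) (by linarith [hζ.2]) (by linarith [hζ.1])
  simp only [sub_sub_cancel] at h1 h2
  have h3 : R ≤ ‖p.pos ζ‖ + ‖p.pos ζ - p.pos σ‖ := by
    rw [← hpos]
    have := norm_sub_le (p.pos ζ) (p.pos ζ - p.pos σ)
    simpa using this
  linarith

/-- Over a short interval of coordinate time the ray is a straight line up to `O(m)`. -/
theorem norm_pos_sub_line_le (h : IsLightPath S m σ p) (hm : 0 < m) (hK : 0 < K)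
    (hweak : ∀ u, 0 < u → u < δ → S.WeakField K u) {R s : ℝ} (hR : 0 < R) (hs : 0 < s)
    (hRm : 2 * m / R < δ) (hpos : ‖p.pos σ‖ = R)
    (htime : 6 * (p.time σ - p.time (σ - s)) ≤ R) (htime' : p.time σ - p.time (σ - s) ≤ 2 * s) :
    ‖p.pos (σ - s) - (p.pos σ - s • (S.W m ‖p.pos σ‖ • p.vel σ))‖
      ≤ ((2 / R ^ 2 * (K * (8 ^ 2 + 16 ^ 2)) * s + 16 * (K * (2 / R))) * s) * m := by
  set Q := fun ζ => S.W m ‖p.pos ζ‖ • p.vel ζ with hQ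
  set E := S.A m ‖p.pos σ‖ * p.timeVel σ with hE
  have hE0 : 0 < E := h.energy_pos hm
  have hr : ∀ ζ ∈ Set.Icc (σ - s) σ, R / 2 ≤ ‖p.pos ζ‖ := fun ζ hζ =>
    h.half_le_norm hm hweak hR hRm hpos htime hζ
  have hu : ∀ ζ ∈ Set.Icc (σ - s) σ, m / ‖p.pos ζ‖ ≤ 2 / R * m := fun ζ hζ => by
    have h1 := hr ζ hζ
    have h2 := h.norm_pos_pos hm hζ.2
    rw [div_mul_eq_mul_div, div_le_div_iff₀ h2 hR]
    nlinarith
  have hw : ∀ ζ ∈ Set.Icc (σ - s) σ, S.WeakField K (m / ‖p.pos ζ‖) := fun ζ hζ =>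
    hweak _ (h.ratio_mem hm hζ.2).1 ((hu ζ hζ).trans_lt (by rwa [div_mul_eq_mul_div]))
  have hAE : ∀ ζ ≤ σ, S.A m ‖p.pos ζ‖ * p.timeVel ζ = E := fun ζ hζ => h.energy_eq hζ
  -- `𝒜 ≤ 2` forces `timeVel ≥ E / 2`, while the elapsed time is at most `2 s`.
  have hE4 : E ≤ 4 := by
    have := norm_sub_le_of_deriv_le (f := fun t => t * (E / 2)) (f' := fun _ => E / 2)
      (fun t _ => ((hasDerivAt_id t).mul_const (E / 2)).hasDerivWithinAt.congr_deriv (by simp))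
      h.hasDeriv_time (a := σ - s) (by linarith) (fun t ht => by
        rw [Real.norm_eq_abs, abs_of_pos (by positivity)]
        have h1 := hAE t ht.2.le
        have h2 : S.A m ‖p.pos t‖ ≤ 2 := (hw t ⟨ht.1, ht.2.le⟩).serA_le
        nlinarith [h.future t ht.2.le])
    have h1 := (le_abs_self _).trans (this.trans htime')
    have h2 : s * E ≤ s * 4 := by linarith
    exact le_of_mul_le_mul_left h2 hs
  have htv : ∀ ζ ∈ Set.Icc (σ - s) σ, p.timeVel ζ ≤ 8 := fun ζ hζ => by
    have h1 := hAE ζ hζ.2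
    have h2 : 1 / 2 ≤ S.A m ‖p.pos ζ‖ := (hw ζ hζ).serA_ge
    nlinarith [h.future ζ hζ.2]
  have hv : ∀ ζ ∈ Set.Icc (σ - s) σ, ‖p.vel ζ‖ ≤ 16 := fun ζ hζ => by
    linarith [h.speed_le hζ.2 (hw ζ hζ), htv ζ hζ]
  set C₁ := 2 / R ^ 2 * (K * (8 ^ 2 + 16 ^ 2)) with hC₁
  have hQd : ∀ ζ ≤ σ, HasDerivWithinAt Q _ (Set.Iic σ) ζ := fun ζ hζ =>
    (h.geodesic_pos ζ hζ).neg.congr_of_mem (fun t _ => by simp [hQ]) hζ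
  have hQle : ∀ ζ ∈ Set.Icc (σ - s) σ, ‖Q σ - Q ζ‖ ≤ C₁ * m * s := fun ζ hζ => by
    have := norm_sub_le_of_deriv_le hQd (g := fun t => t * (C₁ * m)) (g' := fun _ => C₁ * m)
      (fun t _ => ((hasDerivAt_id t).mul_const (C₁ * m)).hasDerivWithinAt.congr_deriv (by simp))
      hζ.2 (fun t ht => by
        have ht' : t ∈ Set.Icc (σ - s) σ := ⟨hζ.1.trans ht.1, ht.2.le⟩
        have hr0 := h.norm_pos_pos hm ht'.2
        rw [norm_neg, norm_smul, norm_smul, norm_inv, norm_norm, inv_mul_cancel₀ hr0.ne', mul_one,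
          StaticMetric.deriv_A hr0.ne' (hw t ht').diffA,
          StaticMetric.deriv_W hr0.ne' (hw t ht').diffW, Real.norm_eq_abs]
        set a' := deriv S.serA (m / ‖p.pos t‖)
        set w' := deriv S.serW (m / ‖p.pos t‖)
        have ha : |a'| ≤ K := (hw t ht').derivA_le
        have hb : |w'| ≤ K := (hw t ht').derivW_le
        have e : 1 / 2 * (-(m / ‖p.pos t‖ ^ 2 * a') * p.timeVel t ^ 2
            - -(m / ‖p.pos t‖ ^ 2 * w') * ‖p.vel t‖ ^ 2)
            = m / (2 * ‖p.pos t‖ ^ 2) * (w' * ‖p.vel t‖ ^ 2 - a' * p.timeVel t ^ 2) := by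
          field_simp; ring
        rw [e, abs_mul, abs_of_pos (by positivity)]
        have e1 : m / (2 * ‖p.pos t‖ ^ 2) ≤ 2 / R ^ 2 * m := by
          rw [div_mul_eq_mul_div, div_le_div_iff₀ (by positivity) (by positivity)]
          have : R ^ 2 ≤ 4 * ‖p.pos t‖ ^ 2 := by nlinarith [hr t ht']
          nlinarith
        have e2 : |w' * ‖p.vel t‖ ^ 2 - a' * p.timeVel t ^ 2| ≤ K * (8 ^ 2 + 16 ^ 2) := by
          have f1 : |w' * ‖p.vel t‖ ^ 2| ≤ K * 16 ^ 2 := by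
            rw [abs_mul, abs_of_nonneg (by positivity : 0 ≤ ‖p.vel t‖ ^ 2)]
            exact mul_le_mul hb (pow_le_pow_left₀ (norm_nonneg _) (hv t ht') 2) (by positivity)
              hK.le
          have f2 : |a' * p.timeVel t ^ 2| ≤ K * 8 ^ 2 := by
            rw [abs_mul, abs_of_nonneg (by positivity : 0 ≤ p.timeVel t ^ 2)]
            exact mul_le_mul ha (pow_le_pow_left₀ (h.future t ht'.2).le (htv t ht') 2)
              (by positivity) hK.le
          have := abs_sub (w' * ‖p.vel t‖ ^ 2) (a' * p.timeVel t ^ 2)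
          linarith
        calc _ ≤ 2 / R ^ 2 * m * (K * (8 ^ 2 + 16 ^ 2)) :=
              mul_le_mul e1 e2 (abs_nonneg _) (by positivity)
          _ = C₁ * m := by rw [hC₁]; ring)
    refine this.trans ?_
    have h0 : 0 < C₁ * m := by positivity
    nlinarith [hζ.1]
  -- The velocity differs from `Q σ` by `O(m)`: one part from the variation of `Q` under the force,
  -- the other from `W - 1`.
  have hfin := norm_sub_le_of_deriv_le (f := fun t => p.pos t - t • Q σ)
    (f' := fun t => p.vel t - Q σ) (g := fun t => t * ((C₁ * s + 16 * (K * (2 / R))) * m))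
    (g' := fun _ => (C₁ * s + 16 * (K * (2 / R))) * m)
    (fun t ht => ((h.hasDeriv_pos t ht).sub
      ((hasDerivAt_id t).smul_const (Q σ)).hasDerivWithinAt).congr_deriv (by simp))
    (fun t _ => ((hasDerivAt_id t).mul_const _).hasDerivWithinAt.congr_deriv (by simp))
    (a := σ - s) (by linarith) (fun t ht => by
      have ht' : t ∈ Set.Icc (σ - s) σ := ⟨ht.1, ht.2.le⟩
      have h1 := hQle t ht'
      have h2 : ‖p.vel t - Q t‖ ≤ 16 * (K * (2 / R)) * m := by
        have e : p.vel t - Q t = -((S.W m ‖p.pos t‖ - 1) • p.vel t) := by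
          simp only [hQ]; module
        rw [e, norm_neg, norm_smul, Real.norm_eq_abs]
        have h3 : |S.W m ‖p.pos t‖ - 1| ≤ K * (m / ‖p.pos t‖) := (hw t ht').serW_sub_one
        have h4 : K * (m / ‖p.pos t‖) ≤ K * (2 / R * m) :=
          mul_le_mul_of_nonneg_left (hu t ht') hK.le
        calc _ ≤ K * (2 / R * m) * 16 :=
              mul_le_mul (h3.trans h4) (hv t ht') (norm_nonneg _) (by positivity)
          _ = _ := by ring
      have h5 := norm_sub_le_norm_sub_add_norm_sub (p.vel t) (Q t) (Q σ)
      rw [norm_sub_rev (Q t)] at h5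
      linarith)
  have e : p.pos (σ - s) - (p.pos σ - s • Q σ)
      = -(p.pos σ - σ • Q σ - (p.pos (σ - s) - (σ - s) • Q σ)) := by
    module
  rw [e, norm_neg]
  refine hfin.trans (le_of_eq ?_)
  ring

end IsLightPath

/-! ### Expansion in `G` and second order inversion. -/

theorem tendsto_zero_of_hasSum {E : Type*} [NormedAddCommGroup E] [NormedSpace ℝ E]
    [FiniteDimensional ℝ E] {a : ℕ → E} {f : ℝ → E} {G₀ : ℝ} (hG₀ : 0 < G₀)
    (h : ∀ G, 0 < G → G < G₀ → HasSum (fun n : ℕ => G ^ (n + 1) • a n) (f G)) :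
    Tendsto f (𝓝[>] (0 : ℝ)) (𝓝 0) := by
  have hg : 0 < G₀ / 2 := by positivity
  set g := G₀ / 2 with hgdef
  have hs : Summable fun n => ‖g ^ (n + 1) • a n‖ :=
    (h g hg (by linarith)).summable.norm
  set T := ∑' n, ‖g ^ (n + 1) • a n‖
  have hlim : Tendsto (fun G : ℝ => G / g * T) (𝓝[>] (0 : ℝ)) (𝓝 0) := by
    have : Tendsto (fun G : ℝ => G / g * T) (𝓝 (0 : ℝ)) (𝓝 (0 / g * T)) :=
      (tendsto_id.div_const g).mul_const T
    simpa using this.mono_left nhdsWithin_le_nhds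
  refine squeeze_zero_norm' ?_ hlim
  have h1 : ∀ᶠ G in 𝓝[>] (0 : ℝ), G < g := nhdsWithin_le_nhds (Iio_mem_nhds hg)
  filter_upwards [h1, self_mem_nhdsWithin] with G hGg hG
  have hG : 0 < G := hG
  have hsum := h G hG (by linarith)
  rw [← hsum.tsum_eq]
  -- The series has no constant term, so each term is at most `G / g` times its value at `g`, where
  -- absolute convergence is known.
  have hle : ∀ n, ‖G ^ (n + 1) • a n‖ ≤ G / g * ‖g ^ (n + 1) • a n‖ := fun n => by
    rw [norm_smul, norm_smul, Real.norm_eq_abs, Real.norm_eq_abs, abs_of_pos (by positivity),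
      abs_of_pos (by positivity), ← mul_assoc]
    apply mul_le_mul_of_nonneg_right _ (norm_nonneg _)
    have : G ^ n ≤ g ^ n := pow_le_pow_left₀ hG.le hGg.le n
    calc G ^ (n + 1) = G * G ^ n := by ring
      _ ≤ G * g ^ n := by gcongr
      _ = G / g * g ^ (n + 1) := by rw [pow_succ]; field_simp
  calc ‖∑' n, G ^ (n + 1) • a n‖ ≤ ∑' n, ‖G ^ (n + 1) • a n‖ :=
        norm_tsum_le_tsum_norm hsum.summable.norm
    _ ≤ ∑' n, G / g * ‖g ^ (n + 1) • a n‖ :=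
        hsum.summable.norm.tsum_le_tsum hle (hs.mul_left _)
    _ = G / g * T := tsum_mul_left

theorem abs_cos_sub_cos_add_le (φ ψ : ℝ) :
    |Real.cos ψ - Real.cos φ + (ψ - φ) * Real.sin φ| ≤ (ψ - φ) ^ 2 := by
  have hd : ∀ t ∈ Set.uIcc φ ψ, HasDerivWithinAt (fun t => Real.cos t + t * Real.sin φ)
      (-Real.sin t + 1 * Real.sin φ) (Set.uIcc φ ψ) t := fun t _ =>
    ((Real.hasDerivAt_cos t).add ((hasDerivAt_id t).mul_const _)).hasDerivWithinAt
  have h := (convex_uIcc φ ψ).norm_image_sub_le_of_norm_hasDerivWithin_le (C := |ψ - φ|) hd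
    (fun t ht => by
      rw [Real.norm_eq_abs, one_mul, neg_add_eq_sub]
      refine (Real.abs_sin_sub_sin_le _ _).trans ?_
      rw [abs_sub_comm]
      exact Set.abs_sub_left_of_mem_uIcc ht) Set.left_mem_uIcc Set.right_mem_uIcc
  rw [Real.norm_eq_abs, Real.norm_eq_abs, abs_mul_abs_self] at h
  refine le_trans (le_of_eq ?_) (h.trans (le_of_eq (by ring)))
  congr 1
  ring

namespace StaticMetric

variable (S : StaticMetric)

/-- Successive substitution in `D = ψ - φ = Φ(ψ) + O(v³)`: first `D = O(v)`, then `D = (1 + γ) v (1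
+ cos φ) + O(v²)`. Inserting this in `cos ψ = cos φ - D sin φ + O(D²)` produces the term `-(1 + γ)²
(1 + cos φ) sin φ`. -/
theorem exists_deflection_taylor {C₁ : ℝ} (hC₁ : 0 ≤ C₁) : ∃ C₂ : ℝ, ∀ v φ ψ : ℝ, 0 < v → v ≤ 1 →
    0 ≤ φ → φ ≤ Real.pi → 0 ≤ ψ → ψ ≤ Real.pi →
    |ψ - S.approxDeflection v ψ - φ| ≤ C₁ * v ^ 3 →
    |ψ - φ - ((1 + S.γ) * v * (1 + Real.cos φ)
      + v ^ 2 * (S.κ * (Real.pi - φ + 1 / 2 * Real.sin (2 * φ))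
        - (1 + S.γ) ^ 2 * (1 + Real.cos φ) * Real.sin φ))| ≤ C₂ * v ^ 3 := by
  set a := 1 + S.γ with ha
  set κ := S.κ
  set C₃ := C₁ + 2 * |a| + 5 * |κ| with hC₃
  set C₄ := C₁ + |a| * C₃ + 5 * |κ| with hC₄
  refine ⟨C₁ + |a| * (C₃ ^ 2 + C₄) + 2 * |κ| * C₃, ?_⟩
  intro v φ ψ hv hv1 hφ0 hφ hψ0 hψ h
  have hapos := abs_nonneg a
  have hκpos := abs_nonneg κ
  have hC₃0 : 0 ≤ C₃ := by positivity
  have hv2 : v ^ 2 ≤ v := by nlinarith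
  have hv3 : v ^ 3 ≤ v ^ 2 := by nlinarith [sq_nonneg v]
  set q := Real.pi - ψ + 1 / 2 * Real.sin (2 * ψ) with hq
  have hq5 : |q| ≤ 5 := by
    have h1 := Real.sin_le_one (2 * ψ)
    have h2 := Real.neg_one_le_sin (2 * ψ)
    have h3 := Real.pi_lt_four
    rw [abs_le]; constructor <;> linarith
  set e₀ := ψ - S.approxDeflection v ψ - φ with he₀
  have hΦ : S.approxDeflection v ψ = a * v * (1 + Real.cos ψ) + v ^ 2 * (κ * q) := rfl
  have hκq : |v ^ 2 * (κ * q)| ≤ 5 * |κ| * v ^ 2 := by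
    rw [abs_mul, abs_mul, abs_of_pos (by positivity)]
    have : |κ| * |q| ≤ |κ| * 5 := mul_le_mul_of_nonneg_left hq5 hκpos
    nlinarith [sq_nonneg v]
  have hD : |ψ - φ| ≤ C₃ * v := by
    have e : ψ - φ = e₀ + a * v * (1 + Real.cos ψ) + v ^ 2 * (κ * q) := by rw [he₀, hΦ]; ring
    have h1 : |a * v * (1 + Real.cos ψ)| ≤ 2 * |a| * v := by
      rw [abs_mul, abs_mul, abs_of_pos hv,
        abs_of_nonneg (by linarith [Real.neg_one_le_cos ψ] : 0 ≤ 1 + Real.cos ψ)]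
      nlinarith [Real.cos_le_one ψ, mul_nonneg hapos hv.le]
    rw [e]
    refine (abs_add_three _ _ _).trans ?_
    rw [hC₃]
    nlinarith
  have hcos := Real.abs_cos_sub_cos_le ψ φ
  set e₁ := ψ - φ - a * v * (1 + Real.cos φ) with he₁
  have he₁' : |e₁| ≤ C₄ * v ^ 2 := by
    have e : e₁ = e₀ + a * v * (Real.cos ψ - Real.cos φ) + v ^ 2 * (κ * q) := by
      rw [he₁, he₀, hΦ]; ring
    have h1 : |a * v * (Real.cos ψ - Real.cos φ)| ≤ |a| * C₃ * v ^ 2 := by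
      rw [abs_mul, abs_mul, abs_of_pos hv]
      calc |a| * v * |Real.cos ψ - Real.cos φ| ≤ |a| * v * (C₃ * v) :=
            mul_le_mul_of_nonneg_left (hcos.trans hD) (by positivity)
        _ = _ := by ring
    rw [e]
    refine (abs_add_three _ _ _).trans ?_
    rw [hC₄]
    nlinarith
  have hquad := abs_cos_sub_cos_add_le φ ψ
  set e₂ := Real.cos ψ - Real.cos φ + (ψ - φ) * Real.sin φ with he₂
  have hquad' : |e₂| ≤ C₃ ^ 2 * v ^ 2 := by
    refine hquad.trans ?_
    rw [← mul_pow, ← sq_abs]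
    exact pow_le_pow_left₀ (abs_nonneg _) hD 2
  have hsin2 : |Real.sin (2 * ψ) - Real.sin (2 * φ)| ≤ 2 * |ψ - φ| := by
    refine (Real.abs_sin_sub_sin_le _ _).trans (le_of_eq ?_)
    rw [← mul_sub, abs_mul, abs_two]
  set e₃ := φ - ψ + 1 / 2 * (Real.sin (2 * ψ) - Real.sin (2 * φ)) with he₃
  have he₃' : |e₃| ≤ 2 * (C₃ * v) := by
    refine (abs_add_le _ _).trans ?_
    rw [abs_sub_comm, abs_mul, abs_of_pos (by norm_num : (0 : ℝ) < 1 / 2)]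
    linarith
  have e : ψ - φ - (a * v * (1 + Real.cos φ)
      + v ^ 2 * (κ * (Real.pi - φ + 1 / 2 * Real.sin (2 * φ))
        - a ^ 2 * (1 + Real.cos φ) * Real.sin φ))
      = e₀ + a * v * (e₂ - e₁ * Real.sin φ) + v ^ 2 * (κ * e₃) := by
    rw [he₀, hΦ, he₁, he₂, he₃, hq]; ring
  rw [e]
  have h1 : |e₂ - e₁ * Real.sin φ| ≤ (C₃ ^ 2 + C₄) * v ^ 2 := by
    have : |e₁ * Real.sin φ| ≤ |e₁| := by
      rw [abs_mul]
      exact mul_le_of_le_one_right (abs_nonneg _) (Real.abs_sin_le_one φ)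
    have := abs_sub e₂ (e₁ * Real.sin φ)
    linarith
  have h2 : |a * v * (e₂ - e₁ * Real.sin φ)| ≤ |a| * (C₃ ^ 2 + C₄) * v ^ 3 := by
    rw [abs_mul, abs_mul, abs_of_pos hv]
    calc |a| * v * |e₂ - e₁ * Real.sin φ| ≤ |a| * v * ((C₃ ^ 2 + C₄) * v ^ 2) :=
          mul_le_mul_of_nonneg_left h1 (by positivity)
      _ = _ := by ring
  have h3 : |v ^ 2 * (κ * e₃)| ≤ 2 * |κ| * C₃ * v ^ 3 := by
    rw [abs_mul, abs_mul, abs_of_pos (by positivity)]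
    calc v ^ 2 * (|κ| * |e₃|) ≤ v ^ 2 * (|κ| * (2 * (C₃ * v))) := by gcongr
      _ = _ := by ring
  refine (abs_add_three _ _ _).trans ?_
  linarith

/-- The spatial metric is conformally Euclidean; nullity gives `√W |l| = √𝒜 l⁰`, and the conformal
factor cancels. -/
theorem measuredAngle_eq {m : ℝ} {x : E3} {l l' : ℝ × E3} (hA : 0 < S.A m ‖x‖)
    (hW : 0 < S.W m ‖x‖) (hl : 0 < l.1) (hl' : 0 < l'.1) (hn : S.lor m x l l = 0)
    (hn' : S.lor m x l' l' = 0) : S.measuredAngle m x l l' = InnerProductGeometry.angle l.2 l'.2 := by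
  have hA' := hA.ne'
  have hs : 0 < √(S.A m ‖x‖) := Real.sqrt_pos.2 hA
  have hsq : √(S.A m ‖x‖) ^ 2 = S.A m ‖x‖ := Real.sq_sqrt hA.le
  have hnorm : ∀ k : ℝ × E3, 0 < k.1 → S.lor m x k k = 0 →
      √(S.W m ‖x‖) * ‖k.2‖ = √(S.A m ‖x‖) * k.1 := fun k hk h0 => by
    rw [← sq_eq_sq₀ (by positivity) (by positivity), mul_pow, mul_pow, Real.sq_sqrt hW.le, hsq]
    simp only [lor, real_inner_self_eq_norm_sq] at h0
    linarith
  have hobs : ∀ k : ℝ × E3, 0 < k.1 → S.observedDirection m x k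
      = (0, (√(S.A m ‖x‖) * k.1)⁻¹ • k.2) := fun k hk => by
    have e : S.lor m x (S.observer m x) k = √(S.A m ‖x‖) * k.1 := by
      simp only [lor, observer, inner_zero_left, mul_zero, sub_zero]
      field_simp
      rw [hsq]
    rw [observedDirection, e, observer]
    ext1
    · simp only [Prod.fst_sub, Prod.smul_fst, smul_eq_mul]
      field_simp
      simp
    · simp
  rw [measuredAngle, hobs l hl, hobs l' hl', InnerProductGeometry.angle]
  congr 1
  have hw : 0 < √(S.W m ‖x‖) := Real.sqrt_pos.2 hW
  have e1 := hnorm l hl hn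
  have e2 := hnorm l' hl' hn'
  simp only [lor, inner_smul_left, inner_smul_right, conj_trivial]
  rw [← e1, ← e2]
  have p1 : 0 < ‖l.2‖ := by
    have : 0 < √(S.W m ‖x‖) * ‖l.2‖ := by rw [e1]; positivity
    exact pos_of_mul_pos_right this hw.le
  have p2 : 0 < ‖l'.2‖ := by
    have : 0 < √(S.W m ‖x‖) * ‖l'.2‖ := by rw [e2]; positivity
    exact pos_of_mul_pos_right this hw.le
  have hwsq : √(S.W m ‖x‖) ^ 2 = S.W m ‖x‖ := Real.sq_sqrt hW.le
  field_simp
  rw [hwsq]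
  ring

end StaticMetric

/-! ### The radial reference ray. -/

namespace IsIngoingRadial

/-- The radial velocity never vanishes, so by Darboux's theorem it has a constant sign; a positive
sign would keep the radius bounded in the past. -/
theorem exists_vel_eq {S : StaticMetric} {m tB σ : ℝ} {y : E3} {p : SpacetimePath} (hm : 0 < m)
    (h : IsIngoingRadial S m y tB σ p) : ∃ c : ℝ, 0 < c ∧ p.vel σ = c • -unitVec y := by
  have hl := h.ray.light
  set r' := fun ζ => ⟪p.pos ζ, p.vel ζ⟫ / ‖p.pos ζ‖ with hr'
  have hr : ∀ ζ ≤ σ, HasDerivWithinAt (fun t => ‖p.pos t‖) (r' ζ) (Set.Iic σ) ζ := fun ζ hζ =>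
    (hl.hasDeriv_pos ζ hζ).norm_of_ne_zero (norm_pos_iff.1 (hl.norm_pos_pos hm hζ))
  have hv : ∀ ζ ≤ σ, p.vel ζ = r' ζ • unitVec y := fun ζ hζ =>
    ((uniqueDiffOn_Iic σ) ζ hζ).eq_deriv _ (hl.hasDeriv_pos ζ hζ)
      (((hr ζ hζ).smul_const (unitVec y)).congr (fun t ht => h.radial t ht) (h.radial ζ hζ))
  have hne : ∀ ζ ∈ Set.Iic σ, r' ζ ≠ 0 := fun ζ hζ h0 => by
    have := hl.vel_ne hm hζ
    rw [hv ζ hζ, h0, zero_smul] at this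
    exact this rfl
  rcases hasDerivWithinAt_forall_lt_or_forall_gt_of_forall_ne (convex_Iic σ) hr hne with hneg | hpos
  · exact ⟨-r' σ, neg_pos.2 (hneg σ Set.self_mem_Iic), by rw [hv σ le_rfl]; module⟩
  · exfalso
    have hle : ∀ a ≤ σ, ‖p.pos a‖ ≤ ‖p.pos σ‖ := fun a ha => by
      have := norm_sub_le_of_deriv_le (f := fun _ => (0 : ℝ)) (f' := fun _ => 0)
        (fun t _ => hasDerivWithinAt_const _ _ _) hr ha
        (fun t ht => by simpa using (hpos t ht.2.le).le)
      simp at this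
      exact this
    obtain ⟨a, ha, ha'⟩ := ((h.ray.from_infinity.eventually_gt_atTop ‖p.pos σ‖).and
      (eventually_le_atBot σ)).exists
    exact absurd (hle a ha') (not_le.2 ha)

/-- Both angles are taken with the inward direction, hence are the supplements of the angles with
`y`. -/
theorem deflection_eq {S : StaticMetric} {m tB σ tB' σ' : ℝ} {y N : E3} {p q : SpacetimePath}
    (hm : 0 < m) (h : IsIngoingRadial S m y tB σ q) (hp : IsRayFromInfinity S m N y tB' σ' p) :
    S.deflection m y N (p.tangent σ') (q.tangent σ)
      = InnerProductGeometry.angle y (p.momentum S m σ')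
        - InnerProductGeometry.angle N (unitVec y) := by
  have hA := hp.light.A_pos hm le_rfl
  have hW := hp.light.W_pos hm le_rfl
  have hn := hp.light.null σ' le_rfl
  have hn' := h.ray.light.null σ le_rfl
  have hy := hp.light.norm_pos_pos hm le_rfl
  rw [hp.pos_end] at hA hW hn hy
  rw [h.ray.pos_end] at hn'
  obtain ⟨c, hc, hv⟩ := h.exists_vel_eq hm
  rw [StaticMetric.deflection, StaticMetric.gravSeparation, S.measuredAngle_eq hA hW
    (hp.light.future σ' le_rfl) (h.ray.light.future σ le_rfl) hn hn', hp.light.angle_momentum hm le_rfl]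
  simp only [SpacetimePath.tangent]
  rw [hv, InnerProductGeometry.angle_smul_right_of_pos _ _ hc, InnerProductGeometry.angle_neg_right,
    InnerProductGeometry.angle_neg_right, unitVec,
    InnerProductGeometry.angle_smul_right_of_pos _ _ (inv_pos.2 hy),
    InnerProductGeometry.angle_smul_right_of_pos _ _ (inv_pos.2 hy),
    InnerProductGeometry.angle_comm y]
  ring

end IsIngoingRadial

/-! ### The limit `G → 0`. -/

theorem tendsto_massParam (M c : ℝ) : Tendsto (massParam M c) (𝓝[>] (0 : ℝ)) (𝓝 0) := by
  have : Tendsto (fun G : ℝ => G * M / c ^ 2) (𝓝 (0 : ℝ)) (𝓝 (0 * M / c ^ 2)) :=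
    (tendsto_id.mul_const M).div_const _
  simpa [massParam] using! this.mono_left nhdsWithin_le_nhds

theorem massParam_pos {M c G : ℝ} (hM : 0 < M) (hc : 0 < c) (hG : 0 < G) : 0 < massParam M c G := by
  rw [massParam]; positivity

theorem eventually_lt_of_pos {G₀ : ℝ} (hG₀ : 0 < G₀) : ∀ᶠ G in 𝓝[>] (0 : ℝ), 0 < G ∧ G < G₀ := by
  have h1 : ∀ᶠ G in 𝓝[>] (0 : ℝ), G < G₀ := nhdsWithin_le_nhds (Iio_mem_nhds hG₀)
  filter_upwards [h1, self_mem_nhdsWithin] with G h1 h2 using ⟨h2, h1⟩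

theorem continuousAt_unitVec {x : E3} (hx : x ≠ 0) : ContinuousAt unitVec x :=
  (continuousAt_id.norm.inv₀ (norm_ne_zero_iff.2 hx)).smul continuousAt_id

namespace IsQuasiMinkowskian

variable {S : StaticMetric} {M c G₀ tB σB : ℝ} {N y : E3} {Γ : ℝ → SpacetimePath}

theorem tendsto_time (h : IsQuasiMinkowskian S M c G₀ N y tB σB Γ) (hG₀ : 0 < G₀) {σ : ℝ}
    (hσ : σ ≤ σB) : Tendsto (fun G => (Γ G).time σ) (𝓝[>] (0 : ℝ)) (𝓝 (tB + (σ - σB))) := by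
  obtain ⟨X0, X, -, hX⟩ := h.expansion
  have := tendsto_zero_of_hasSum (a := fun n => X0 (n + 1) σ) hG₀ fun G h1 h2 => (hX G h1 h2 σ hσ).1
  simpa using this.add_const (tB + (σ - σB))

theorem tendsto_pos (h : IsQuasiMinkowskian S M c G₀ N y tB σB Γ) (hG₀ : 0 < G₀) {σ : ℝ}
    (hσ : σ ≤ σB) : Tendsto (fun G => (Γ G).pos σ) (𝓝[>] (0 : ℝ)) (𝓝 (y + (σ - σB) • N)) := by
  obtain ⟨X0, X, -, hX⟩ := h.expansion
  have := tendsto_zero_of_hasSum (a := fun n => X (n + 1) σ) hG₀ fun G h1 h2 => (hX G h1 h2 σ hσ).2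
  simpa using this.add_const (y + (σ - σB) • N)

/-- The direction of the ray at the reception point tends to the direction of emission. -/
theorem tendsto_momentum (h : IsQuasiMinkowskian S M c G₀ N y tB σB Γ) (hM : 0 < M) (hc : 0 < c)
    (hG₀ : 0 < G₀) (hN : ‖N‖ = 1) (hy : y ≠ 0) :
    Tendsto (fun G => (Γ G).momentum S (massParam M c G) σB) (𝓝[>] (0 : ℝ)) (𝓝 N) := by
  obtain ⟨δ, hδ, K, hK, hweak⟩ := S.exists_weakField
  have hev := eventually_lt_of_pos hG₀
  have hm := tendsto_massParam M c
  have hR : 0 < ‖y‖ := norm_pos_iff.2 hy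
  set R := ‖y‖
  -- The elapsed time tends to `s`, so it is eventually below `2 s`, and `6 * (2 s) = R` is what the
  -- short-time estimate requires.
  set s := R / 12 with hs
  have hs0 : 0 < s := by positivity
  set Q := fun G => S.W (massParam M c G) ‖(Γ G).pos σB‖ • (Γ G).vel σB with hQ
  have htime : Tendsto (fun G => (Γ G).time σB - (Γ G).time (σB - s)) (𝓝[>] (0 : ℝ)) (𝓝 s) := by
    have := (h.tendsto_time hG₀ le_rfl).sub (h.tendsto_time hG₀ (σ := σB - s) (by linarith))
    simpa using this
  have hline : Tendsto (fun G => (Γ G).pos (σB - s) - ((Γ G).pos σB - s • Q G)) (𝓝[>] (0 : ℝ))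
      (𝓝 0) := by
    refine squeeze_zero_norm' (a := fun G => ((2 / R ^ 2 * (K * (8 ^ 2 + 16 ^ 2)) * s
      + 16 * (K * (2 / R))) * s) * massParam M c G) ?_ (by simpa using hm.const_mul _)
    have h1 : ∀ᶠ G in 𝓝[>] (0 : ℝ), 2 * massParam M c G / R < δ :=
      ((hm.const_mul 2).div_const R).eventually (gt_mem_nhds (by simpa using hδ))
    have h2 : ∀ᶠ G in 𝓝[>] (0 : ℝ), (Γ G).time σB - (Γ G).time (σB - s) < 2 * s :=
      htime.eventually (gt_mem_nhds (by linarith))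
    filter_upwards [hev, h1, h2] with G hG h1 h2
    have hray := h.ray G hG.1 hG.2
    exact hray.light.norm_pos_sub_line_le (massParam_pos hM hc hG.1) hK hweak hR hs0 h1
      (by rw [hray.pos_end]) (by rw [hs] at h2 ⊢; linarith) h2.le
  -- The expansion controls positions but not velocities; `s • Q` is recovered as a difference of
  -- two positions.
  have hQN : Tendsto Q (𝓝[>] (0 : ℝ)) (𝓝 N) := by
    have h1 := hline.sub ((h.tendsto_pos hG₀ (σ := σB - s) (by linarith)).sub
      (h.tendsto_pos hG₀ le_rfl))
    have h2 := h1.const_smul s⁻¹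
    have e1 : ∀ G, (Γ G).pos (σB - s) - ((Γ G).pos σB - s • Q G)
        - ((Γ G).pos (σB - s) - (Γ G).pos σB) = s • Q G := fun G => by abel
    have e2 : 0 - (y + (σB - s - σB) • N - (y + (σB - σB) • N)) = s • N := by module
    simpa only [e1, e2, inv_smul_smul₀ hs0.ne'] using h2
  have hunit : Tendsto (fun G => unitVec (Q G)) (𝓝[>] (0 : ℝ)) (𝓝 N) := by
    have hN0 : N ≠ 0 := by rintro rfl; simp at hN
    have := (continuousAt_unitVec hN0).tendsto.comp hQN
    simpa [unitVec, hN] using! this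
  have hidx : Tendsto (fun G => S.index (massParam M c G / R)) (𝓝[>] (0 : ℝ)) (𝓝 1) := by
    have h0 : Tendsto (fun G => massParam M c G / R) (𝓝[>] (0 : ℝ)) (𝓝 0) := by
      simpa using hm.div_const R
    have := S.analyticAt_index.continuousAt.tendsto.comp h0
    rwa [S.index_zero] at this
  -- `P` has the direction of `Q` and norm `index (m / R)`, which tends to `1`.
  have hprod := hidx.smul hunit
  rw [one_smul] at hprod
  refine hprod.congr' ?_
  filter_upwards [hev] with G hG
  have hray := h.ray G hG.1 hG.2
  have hmG := massParam_pos hM hc hG.1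
  have hW := hray.light.W_pos hmG le_rfl
  have hv := norm_pos_iff.2 (hray.light.vel_ne hmG le_rfl)
  have e1 : unitVec (Q G) = unitVec ((Γ G).momentum S (massParam M c G) σB) := by
    rw [hray.light.unitVec_momentum hmG le_rfl, hQ, unitVec, unitVec, norm_smul, Real.norm_eq_abs,
      abs_of_pos hW, smul_smul]
    congr 1
    field_simp
  have e2 := hray.light.norm_momentum hmG le_rfl
  rw [hray.pos_end] at e2
  rw [e1, ← e2, unitVec, smul_inv_smul₀]
  have := (S.posW _ (hray.light.ratio_mem hmG le_rfl).1 (hray.light.ratio_mem hmG le_rfl).2)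
  have hA := (S.posA _ (hray.light.ratio_mem hmG le_rfl).1 (hray.light.ratio_mem hmG le_rfl).2)
  rw [hray.light.norm_momentum hmG le_rfl]
  exact (Real.sqrt_pos.2 (div_pos this hA)).ne'

end IsQuasiMinkowskian

/-! ### The deflection formula. -/

theorem angle_ne_zero_of_line_exterior {R : ℝ} {N y : E3} (hN : ‖N‖ = 1) (hR : 0 < R)
    (h : ∀ t ≤ (0 : ℝ), R < ‖t • N + y‖) :
    InnerProductGeometry.angle N (unitVec y) ≠ 0 := by
  have hy : y ≠ 0 := by
    rintro rfl
    have := h 0 le_rfl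
    simp at this
    linarith
  have hy' := norm_pos_iff.2 hy
  intro h0
  rw [unitVec, InnerProductGeometry.angle_smul_right_of_pos _ _ (inv_pos.2 hy')] at h0
  have h1 := InnerProductGeometry.inner_eq_mul_norm_of_angle_eq_zero h0
  -- If `N` pointed along `y`, the half-line would reach the centre at this parameter.
  have h2 := h (-‖y‖) (by linarith)
  have h3 : ‖(-‖y‖) • N + y‖ ^ 2 = 0 := by
    rw [norm_add_sq_real, norm_smul, inner_smul_left, h1, hN]
    simp
    ring
  have h4 : ‖(-‖y‖) • N + y‖ = 0 := by simpa using h3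
  linarith

theorem proposition8 (S : StaticMetric) :
    ∃ C : ℝ, ∀ (M c G₀ : ℝ) (Ne xB : E3) (tB σB : ℝ) (Γ : ℝ → SpacetimePath) (φB : ℝ),
      0 < M → 0 < c → 0 < G₀ → ‖Ne‖ = 1 →
      IsQuasiMinkowskian S M c G₀ Ne xB tB σB Γ →
      (∀ G, 0 < G → G < G₀ → ∀ σ ≤ σB, S.rh (massParam M c G) < ‖(σ - σB) • Ne + xB‖) →
      φB = InnerProductGeometry.angle Ne (unitVec xB) →
      φB ≠ Real.pi →
      ∀ᶠ G in 𝓝[>] (0 : ℝ), ∀ m b : ℝ,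
        m = massParam M c G →
        b = S.impactParameter m xB ((Γ G).tangent σB) →
        0 < b ∧
        ∀ (Γrd : SpacetimePath) (ζB : ℝ), IsIngoingRadial S m xB tB ζB Γrd →
          |S.deflection m xB Ne ((Γ G).tangent σB) (Γrd.tangent ζB)
            - ((1 + S.γ) * (G * M) / (c ^ 2 * b) * (1 + Real.cos φB)
              + G ^ 2 * M ^ 2 / (c ^ 4 * b ^ 2)
                * (S.κ * (Real.pi - φB + 1 / 2 * Real.sin (2 * φB))
                  - (1 + S.γ) ^ 2 * (1 + Real.cos φB) * Real.sin φB))|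
            ≤ C * (G ^ 3 * M ^ 3 / (c ^ 6 * b ^ 3)) := by
  obtain ⟨δ, hδ, K, hK, hweak⟩ := S.exists_weakField
  obtain ⟨C, hC⟩ := S.exists_deflection_taylor
    (C₁ := Real.pi / 2 * (16 * K * Real.pi)) (by have := Real.pi_pos; positivity)
  refine ⟨C, fun M c G₀ N y tB σB Γ φ hM hc hG₀ hN hΓ hext hφ hφpi => ?_⟩
  have hev := eventually_lt_of_pos hG₀
  have hm := tendsto_massParam M c
  have hline : ∀ t ≤ (0 : ℝ), S.rh (massParam M c (G₀ / 2)) < ‖t • N + y‖ := fun t ht => by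
    simpa using hext (G₀ / 2) (by linarith) (by linarith) (t + σB) (by linarith)
  have hrh : 0 < S.rh (massParam M c (G₀ / 2)) :=
    mul_pos S.ρ_pos (massParam_pos hM hc (by linarith))
  have hφ0 : φ ≠ 0 := hφ ▸ angle_ne_zero_of_line_exterior hN hrh hline
  have hy : y ≠ 0 := by
    rintro rfl
    have := hline 0 le_rfl
    simp at this
    linarith
  have hR : 0 < ‖y‖ := norm_pos_iff.2 hy
  have hN0 : N ≠ 0 := by rintro rfl; simp at hN
  have hφnonneg : 0 ≤ φ := hφ ▸ InnerProductGeometry.angle_nonneg _ _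
  have hφle : φ ≤ Real.pi := hφ ▸ InnerProductGeometry.angle_le_pi _ _
  have hφpos : 0 < φ := lt_of_le_of_ne hφnonneg (Ne.symm hφ0)
  have hφlt : φ < Real.pi := lt_of_le_of_ne hφle hφpi
  have hφ' : InnerProductGeometry.angle y N = φ := by
    rw [hφ, unitVec, InnerProductGeometry.angle_smul_right_of_pos _ _ (inv_pos.2 hR),
      InnerProductGeometry.angle_comm]
  set P := fun G => (Γ G).momentum S (massParam M c G) σB with hPdef
  have hP : Tendsto P (𝓝[>] (0 : ℝ)) (𝓝 N) := hΓ.tendsto_momentum hM hc hG₀ hN hy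
  set b₀ := ‖E3.cross y N‖ with hb₀def
  have hb₀ : 0 < b₀ := by
    rw [hb₀def, norm_cross_eq, hφ', hN, mul_one]
    exact mul_pos hR (Real.sin_pos_of_pos_of_lt_pi hφpos hφlt)
  have hb : Tendsto (fun G => ‖E3.cross y (P G)‖) (𝓝[>] (0 : ℝ)) (𝓝 b₀) :=
    (((E3.continuous_cross_right y).tendsto N).comp hP).norm
  have hψ : Tendsto (fun G => InnerProductGeometry.angle y (P G)) (𝓝[>] (0 : ℝ)) (𝓝 φ) := by
    have h1 := (InnerProductGeometry.continuousAt_angle (x := (y, N)) hy hN0).tendsto.comp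
      (tendsto_const_nhds.prodMk_nhds hP)
    simpa only [hφ'] using! h1
  have hv : Tendsto (fun G => massParam M c G / ‖E3.cross y (P G)‖) (𝓝[>] (0 : ℝ)) (𝓝 0) := by
    simpa only [zero_div] using! hm.div hb hb₀.ne'
  -- The limit `φ` is interior to `(0, π)`, so the corrected angle is eventually in the range where
  -- `angle_polarVec` applies.
  have hη : Tendsto (fun G => InnerProductGeometry.angle y (P G)
      - S.approxDeflection (massParam M c G / ‖E3.cross y (P G)‖)
        (InnerProductGeometry.angle y (P G))) (𝓝[>] (0 : ℝ)) (𝓝 φ) := by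
    have hcont : Continuous fun q : ℝ × ℝ => S.approxDeflection q.1 q.2 := by
      unfold StaticMetric.approxDeflection; fun_prop
    have h1 := (hcont.tendsto (0, φ)).comp (hv.prodMk_nhds hψ)
    have h2 : S.approxDeflection 0 φ = 0 := by simp [StaticMetric.approxDeflection]
    simp only [h2] at h1
    simpa using hψ.sub h1
  filter_upwards [hev, hb.eventually (lt_mem_nhds hb₀), hv.eventually (gt_mem_nhds one_pos),
    hη.eventually (lt_mem_nhds hφpos), hη.eventually (gt_mem_nhds hφlt),
    (hm.div_const ‖y‖).eventually (gt_mem_nhds (by simpa using hδ)),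
    hv.eventually (gt_mem_nhds (half_pos hδ))] with G hG hbG hv1 hη0 hηπ hmR hmb
  rintro _ b rfl hbdef
  have hray := hΓ.ray G hG.1 hG.2
  have hmG := massParam_pos hM hc hG.1
  set m := massParam M c G with hmdef
  set ψ := InnerProductGeometry.angle y (P G) with hψdef
  have hbJ : b = ‖E3.cross y (P G)‖ := by
    have := S.impactParameter_eq m σB (Γ G)
    rw [hray.pos_end] at this
    rw [hbdef, this]
  rw [← hbJ] at hbG hv1 hη0 hηπ hmb
  refine ⟨hbG, fun q ζB hq => ?_⟩
  rw [hq.deflection_eq hmG hray, ← hφ]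
  have hpe := hray.pos_end
  have hJ0 : E3.cross y (P G) ≠ 0 := by rw [← norm_pos_iff, ← hbJ]; exact hbG
  have hcm := hray.light.centralMotion hmG (J := E3.cross y (P G)) (by rw [hpe]) hJ0
  -- The condition `b > 2 m / δ` holds for small `G` because `m / b → 0`.
  have hratio : ∀ ζ ≤ σB, m / ‖(Γ G).pos ζ‖ < δ := fun ζ hζ => by
    refine hray.light.ratio_lt hmG hδ hweak (by rwa [hpe]) ?_ hζ
    rw [hpe]
    change _ < ‖E3.cross y (P G)‖
    rw [← hbJ, div_lt_iff₀ hδ]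
    rw [div_lt_iff₀ hbG] at hmb
    linarith
  have hcore := hcm.norm_polarVec_sub_direction_le S (N := N) hK hweak hmG hratio
    (fun ζ hζ => div_pos (hray.light.energy_pos hmG) (hray.light.W_pos hmG hζ))
    (fun ζ hζ => hray.light.norm_momentum hmG hζ)
    (fun ζ hζ => hray.light.force_eq hmG hζ
      (hweak _ (hray.light.ratio_mem hmG hζ).1 (hratio ζ hζ)))
    hray.from_infinity (hray.direction.congr' (by
      filter_upwards [eventually_le_atBot σB] with ζ hζ
      exact (hray.light.unitVec_momentum hmG hζ).symm))
  rw [hpe] at hcore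
  change ‖polarVec (E3.cross y (P G)) y (ψ - S.approxDeflection (m / ‖E3.cross y (P G)‖) ψ) - N‖
    ≤ _ at hcore
  rw [← hbJ] at hcore
  have hJy : ⟪E3.cross y (P G), y⟫ = 0 := E3.inner_cross_self_left _ _
  have hw1 := norm_polarVec hJ0 hy hJy (ψ - S.approxDeflection (m / b) ψ)
  have hwa := angle_polarVec hJ0 hy hJy hη0.le hηπ.le
  set w := polarVec (E3.cross y (P G)) y (ψ - S.approxDeflection (m / b) ψ)
  have hang := angle_le_mul_norm_sub hw1 hN
  -- Two spherical triangle inequalities between `w`, `N` and the direction of `y` turn the distance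
  -- bound into a bound on angles.
  have hclose : |ψ - S.approxDeflection (m / b) ψ - φ|
      ≤ Real.pi / 2 * (16 * K * Real.pi) * (m / b) ^ 3 := by
    have t1 := InnerProductGeometry.angle_le_angle_add_angle w N (unitVec y)
    have t2 := InnerProductGeometry.angle_le_angle_add_angle N w (unitVec y)
    rw [InnerProductGeometry.angle_comm N w] at t2
    rw [hwa, ← hφ] at t1 t2
    have hpi := Real.pi_pos
    have t3 := mul_le_mul_of_nonneg_left hcore (half_pos hpi).le
    rw [abs_le]
    constructor <;> linarith
  have hfin := hC (m / b) φ ψ (div_pos hmG hbG) hv1.le hφnonneg hφle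
    (InnerProductGeometry.angle_nonneg _ _) (InnerProductGeometry.angle_le_pi _ _) hclose
  have e1 : (1 + S.γ) * (G * M) / (c ^ 2 * b) = (1 + S.γ) * (m / b) := by
    rw [hmdef, massParam]; field_simp
  have e2 : G ^ 2 * M ^ 2 / (c ^ 4 * b ^ 2) = (m / b) ^ 2 := by
    rw [hmdef, massParam]; field_simp
  have e3 : G ^ 3 * M ^ 3 / (c ^ 6 * b ^ 3) = (m / b) ^ 3 := by
    rw [hmdef, massParam]; field_simp
  rw [e1, e2, e3]
  exact hfin
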